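/- Let $n,p\ge 1$ be integers, let $B$ be the open unit ball of $\mathbb{R}^n$, and for $\theta\in\mathbb{R}$ let $e^{i\theta}B=\{e^{i\theta}x : x\in B\}\subset\mathbb{C}^n$ (so $B=e^{i0}B$ is regarded as a subset of $\mathbb{C}^n$). Put $\widehat B_p=\bigcup_{k=0}^{p-1}e^{k\pi i/p}B$ and $M=\bigcup_{\psi\in\mathbb{R}}e^{i\psi}B$. Call $u:B\to\mathbb{C}$ polyharmonic of order $p$ if $u$ is real-analytic on $B$ and $\Delta^p u=0$ there. A continuation of $u$ is a function $U$ that is holomorphic in a $\mathbb{C}^n$-neighbourhood of each point of $M$ and satisfies $U=u$ on $B$. Every polyharmonic $u$ of order $p$ on $B$ has a continuation, and any two continuations coincide on $M$; we again write $u$ for this continuation. Let $L^2(\widehat B_p)$ be the Hilbert space of (classes of) measurable functions $u$ on $\widehat B_p$ with $\frac1p\sum_{k=0}^{p-1}\int_B|u(e^{k\pi i/p}y)|^2\,dy<\infty$, with the inner product $$\langle u,v\rangle=\frac1p\sum_{k=0}^{p-1}\int_B u(e^{k\pi i/p}y)\,\overline{v(e^{k\pi i/p}y)}\,dy .$$ Let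 the polyharmonic Bergman space $b_p^2(\widehat B_p)$ be the set of those polyharmonic functions $u$ of order $p$ on $B$ whose continuation belongs to $L^2(\widehat B_p)$. Then $b_p^2(\widehat B_p)$ is a closed linear subspace of $L^2(\widehat B_p)$; hence it is a Hilbert space with the above inner product. Moreover it has a unique reproducing kernel: there is exactly one function $R_p:\widehat B_p\times\widehat B_p\to\mathbb{C}$ such that, for every $x\in\widehat B_p$, the function $R_p(x,\cdot)$ is (the restriction to $\widehat B_p$ of) an element of $b_p^2(\widehat B_p)$ and $u(x)=\langle u,R_p(x,\cdot)\rangle$ for all $u\in b_p^2(\widehat B_p)$. -/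

import Mathlib

open MeasureTheory Set Metric
open scoped ENNReal ComplexConjugate

noncomputable section

namespace PolyBergman

/-! ### Polyharmonic functions -/

/-- The space of polyharmonic functions of order `p` on an open set `G` of `ℝⁿ`: real-analytic
complex-valued functions on `G` whose `p`-th iterated Laplacian vanishes on `G`. -/
def IsPolyharmonicOn {n : ℕ} (p : ℕ) (u : EuclideanSpace ℝ (Fin n) → ℂ)
    (G : Set (EuclideanSpace ℝ (Fin n))) : Prop :=
  AnalyticOnNhd ℝ u G ∧ ∀ x ∈ G, (Laplacian.laplacian^[p] u) x = 0

/-! ### Rotated balls -/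

/-- The open unit ball of `ℝⁿ`. -/
def unitBall (n : ℕ) : Set (EuclideanSpace ℝ (Fin n)) := ball 0 1

/-- The point `e^{iθ} x` of `ℂⁿ`, for a real vector `x`. -/
def rot {n : ℕ} (θ : ℝ) (x : EuclideanSpace ℝ (Fin n)) : EuclideanSpace ℂ (Fin n) :=
  WithLp.toLp 2 fun j => Complex.exp (θ * Complex.I) * (x j : ℂ)

/-- The angle `kπ/p`. -/
def angle (p k : ℕ) : ℝ := k * Real.pi / p

/-- The union `⋃_{0 ≤ k < p} e^{ikπ/p} B` of rotated unit balls. -/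
def ballHat (n p : ℕ) : Set (EuclideanSpace ℂ (Fin n)) :=
  ⋃ k ∈ Finset.range p, rot (angle p k) '' unitBall n

/-- The union `{e^{iψ} x : ψ ∈ ℝ, x ∈ B}` of all rotated unit balls. -/
def allRotations (n : ℕ) : Set (EuclideanSpace ℂ (Fin n)) :=
  ⋃ ψ : ℝ, rot ψ '' unitBall n

/-- `U` is an analytic continuation of `u : B → ℂ` to all rotated balls: `U` is holomorphic on a
neighbourhood in `ℂⁿ` of each point of `{e^{iψ} x : ψ ∈ ℝ, x ∈ B}` and agrees with `u` on `B`. -/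
def IsContinuation {n : ℕ} (u : EuclideanSpace ℝ (Fin n) → ℂ)
    (U : EuclideanSpace ℂ (Fin n) → ℂ) : Prop :=
  AnalyticOnNhd ℂ U (allRotations n) ∧ ∀ x ∈ unitBall n, U (rot 0 x) = u x

/-! ### The space `L²` of the union of rotated balls -/

/-- The measure `f ↦ (1/p) ∑_{k<p} ∫_B f(e^{ikπ/p} y) dy`, the average of the Lebesgue measures of
the `p` rotated balls. It is concentrated on `ballHat n p`. -/
def measureHat (n p : ℕ) : Measure (EuclideanSpace ℂ (Fin n)) :=
  (p : ℝ≥0∞)⁻¹ • ∑ k ∈ Finset.range p,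
    Measure.map (rot (angle p k)) (volume.restrict (unitBall n))

/-- The Hilbert space `L²` of the union of rotated balls. -/
abbrev L2Hat (n p : ℕ) : Type := Lp ℂ 2 (measureHat n p)

/-- The averaged inner product `(1/p) ∑_{k<p} ∫_B u(e^{ikπ/p} y) conj (v(e^{ikπ/p} y)) dy`. -/
def avgInner (n p : ℕ) (u v : EuclideanSpace ℂ (Fin n) → ℂ) : ℂ :=
  (1 / (p : ℂ)) * ∑ k ∈ Finset.range p,
    ∫ y in unitBall n, u (rot (angle p k) y) * conj (v (rot (angle p k) y))

/-! ### Linearity of the polyharmonic equation -/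

section Linear

variable {n : ℕ} {G : Set (EuclideanSpace ℝ (Fin n))}

theorem analyticOnNhd_laplacian {f : EuclideanSpace ℝ (Fin n) → ℂ} (hf : AnalyticOnNhd ℝ f G) :
    AnalyticOnNhd ℝ (Laplacian.laplacian f) G := by
  rw [InnerProductSpace.laplacian_eq_iteratedFDeriv_stdOrthonormalBasis]
  intro x hx
  have h := hf.iteratedFDeriv 2 x hx
  refine Finset.analyticAt_fun_sum _ fun i _ => ?_
  exact ((ContinuousMultilinearMap.apply ℝ (fun _ : Fin 2 => EuclideanSpace ℝ (Fin n)) ℂ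
    ![stdOrthonormalBasis ℝ _ i, stdOrthonormalBasis ℝ _ i]).analyticAt _).comp h

theorem laplacian_iter_congr (hG : IsOpen G) (p : ℕ) {f g : EuclideanSpace ℝ (Fin n) → ℂ}
    (h : EqOn f g G) : EqOn (Laplacian.laplacian^[p] f) (Laplacian.laplacian^[p] g) G := by
  induction p generalizing f g with
  | zero => exact h
  | succ p ih =>
    simp only [Function.iterate_succ_apply]
    refine ih fun x hx => ?_
    exact (InnerProductSpace.laplacian_congr_nhds
      (h.eventuallyEq_of_mem (hG.mem_nhds hx))).eq_of_nhds

theorem laplacian_iter_add_smul (hG : IsOpen G) (p : ℕ) (a : ℂ)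
    {f g : EuclideanSpace ℝ (Fin n) → ℂ}
    (hf : AnalyticOnNhd ℝ f G) (hg : AnalyticOnNhd ℝ g G) :
    EqOn (Laplacian.laplacian^[p] (a • f + g))
      (a • Laplacian.laplacian^[p] f + Laplacian.laplacian^[p] g) G := by
  induction p generalizing f g with
  | zero => exact fun _ _ => rfl
  | succ p ih =>
    simp only [Function.iterate_succ_apply]
    refine EqOn.trans (laplacian_iter_congr hG p fun x hx => ?_)
      (ih (analyticOnNhd_laplacian hf) (analyticOnNhd_laplacian hg))
    have h1 : ContDiffAt ℝ 2 f x := (hf x hx).contDiffAt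
    have h2 : ContDiffAt ℝ 2 g x := (hg x hx).contDiffAt
    have h3 : ContDiffAt ℝ 2 (a • f) x := h1.const_smul a
    rw [h3.laplacian_add h2, InnerProductSpace.laplacian_smul a h1]
    rfl

theorem IsPolyharmonicOn.smul_add (hG : IsOpen G) {p : ℕ} (a : ℂ)
    {f g : EuclideanSpace ℝ (Fin n) → ℂ}
    (hf : IsPolyharmonicOn p f G) (hg : IsPolyharmonicOn p g G) :
    IsPolyharmonicOn p (a • f + g) G := by
  refine ⟨AnalyticOnNhd.add (f := a • f) (fun x hx => (hf.1 x hx).const_smul) hg.1, fun x hx => ?_⟩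
  rw [laplacian_iter_add_smul hG p a hf.1 hg.1 hx]
  simp [hf.2 x hx, hg.2 x hx]

theorem IsPolyharmonicOn.zero (p : ℕ) :
    IsPolyharmonicOn p (0 : EuclideanSpace ℝ (Fin n) → ℂ) G := by
  refine ⟨analyticOnNhd_const, fun x _ => ?_⟩
  induction p with
  | zero => rfl
  | succ p ih =>
    have h : Laplacian.laplacian (0 : EuclideanSpace ℝ (Fin n) → ℂ) = 0 :=
      InnerProductSpace.laplacian_const (c := (0 : ℂ))
    rwa [Function.iterate_succ_apply, h]

theorem IsContinuation.smul_add (a : ℂ) {u v : EuclideanSpace ℝ (Fin n) → ℂ}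
    {U V : EuclideanSpace ℂ (Fin n) → ℂ} (hu : IsContinuation u U) (hv : IsContinuation v V) :
    IsContinuation (a • u + v) (a • U + V) := by
  refine ⟨AnalyticOnNhd.add (f := a • U) (fun x hx => (hu.1 x hx).const_smul) hv.1, fun x hx => ?_⟩
  simp [hu.2 x hx, hv.2 x hx]

end Linear

/-! ### The polyharmonic Bergman space -/

/-- `U` is (the analytic continuation of) an element of the polyharmonic Bergman space: it continues
a polyharmonic function of order `p` on `B` and is square-integrable on the `p` rotated balls. -/
def IsBergmanFunction (n p : ℕ) (U : EuclideanSpace ℂ (Fin n) → ℂ) : Prop :=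
  (∃ u, IsPolyharmonicOn p u (unitBall n) ∧ IsContinuation u U) ∧ MemLp U 2 (measureHat n p)

theorem IsBergmanFunction.smul_add {n p : ℕ} (a : ℂ) {U V : EuclideanSpace ℂ (Fin n) → ℂ}
    (hU : IsBergmanFunction n p U) (hV : IsBergmanFunction n p V) :
    IsBergmanFunction n p (a • U + V) := by
  obtain ⟨⟨u, hu, huU⟩, hU2⟩ := hU
  obtain ⟨⟨v, hv, hvV⟩, hV2⟩ := hV
  exact ⟨⟨a • u + v, hu.smul_add isOpen_ball a hv, huU.smul_add a hvV⟩,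
    (hU2.const_smul a).add hV2⟩

theorem IsBergmanFunction.zero (n p : ℕ) : IsBergmanFunction n p 0 :=
  ⟨⟨0, IsPolyharmonicOn.zero p, analyticOnNhd_const, fun _ _ => rfl⟩, MemLp.zero⟩

/-- The polyharmonic Bergman space, as a linear subspace of `L²`: the classes of the
square-integrable analytic continuations of polyharmonic functions of order `p` on `B`. -/
def bergmanSpace (n p : ℕ) : Submodule ℂ (L2Hat n p) where
  carrier := {f | ∃ U, IsBergmanFunction n p U ∧ f =ᵐ[measureHat n p] U}
  zero_mem' := ⟨0, IsBergmanFunction.zero n p, Lp.coeFn_zero ..⟩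
  add_mem' := by
    rintro f g ⟨U, hU, hfU⟩ ⟨V, hV, hgV⟩
    refine ⟨(1 : ℂ) • U + V, hU.smul_add 1 hV, ?_⟩
    rw [one_smul]
    exact (Lp.coeFn_add f g).trans (hfU.add hgV)
  smul_mem' := by
    rintro a f ⟨U, hU, hfU⟩
    refine ⟨a • U + 0, hU.smul_add a (IsBergmanFunction.zero n p), ?_⟩
    rw [add_zero]
    exact (Lp.coeFn_smul a f).trans (hfU.const_smul a)

/-- `R` is a reproducing kernel of the polyharmonic Bergman space: for each point `x` of the union
of rotated balls, `R x` belongs to the space and `u(x) = ⟨u, R x⟩` for every `u` in the space. -/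
def IsReproducingKernel (n p : ℕ)
    (R : EuclideanSpace ℂ (Fin n) → EuclideanSpace ℂ (Fin n) → ℂ) : Prop :=
  ∀ x ∈ ballHat n p, IsBergmanFunction n p (R x) ∧
    ∀ U, IsBergmanFunction n p U → U x = avgInner n p U (R x)

end PolyBergman

end

open PolyBergman

noncomputable section

namespace PolyBergman

open MvPolynomial Filter Topology

section Polynomials

variable {n : ℕ}

/-! ### Polynomials as functions on real and complex space -/

/-! Everything follows from one estimate. Near the origin a polyharmonic `u` is the sum of
homogeneous polynomials `P k`, each annihilated by the `p`-th power of the Laplacian. Near every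
point of `M` these satisfy `|P k z| ≤ K ‖u‖ θ ^ k` with `θ < 1` and with `K`, `θ` independent of `u`
(`exists_norm_eval_component_sq_le`); only the square integrability of `u` on the real ball `B`
enters.

The estimate combines two facts.

(a) Under the weight `1 - |x|²`, `P j` and `P k` are orthogonal as soon as `|j - k| ≥ 4p`
(`wint_mul_eq_zero`), by Green's identity for the weights `(1 - |x|²)₊ ^ m` and Euler's relation.
Hence `s ↦ ∫ u(sy) (1 - |y|²) conj (P k y) dy`, which is analytic on `(-1, 1)`, is a polynomial with
exponents within `4p` of `k`, and its coefficient at `s ^ k` is the squared weighted norm of `P k`.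
Cauchy–Schwarz bounds its values for `s` near 1, and values on an interval control the coefficients
when the degree is bounded; so the weighted norm of `P k` is at most `K t⁻ᵏ ‖u‖` for any `t < 1`
(`exists_wnormSq_le`).

(b) In a complex neighbourhood of the closed real ball a homogeneous polynomial of degree `k` is
bounded by its weighted norm up to a factor `C l ^ k`, with `l > 1` as close to 1 as desired
(`exists_norm_eval_sq_le`).

At a point `e^{iψ} x` with `|x| < 1`, homogeneity makes the rotation harmless and gains a power `σ ^
k` with `σ < 1` that beats both losses.

Consequences: applied to the dilates `u(r ·)`, the estimate gives convergence of the series to a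
continuation; summed over `k`, it bounds point evaluations; applied to differences in a Cauchy
sequence, it gives convergence of each component and a dominating geometric series, so the space is
closed. The Riesz representation theorem then yields the kernel. -/

/-- The inclusion of `ℝⁿ` into `ℂⁿ`. -/
def cx (x : EuclideanSpace ℝ (Fin n)) : Fin n → ℂ := fun j => (x j : ℂ)

@[simp] theorem cx_apply (x : EuclideanSpace ℝ (Fin n)) (j : Fin n) : cx x j = (x j : ℂ) := rfl

theorem cx_add (x y : EuclideanSpace ℝ (Fin n)) : cx (x + y) = cx x + cx y := by
  ext; simp

theorem cx_sub (x y : EuclideanSpace ℝ (Fin n)) : cx (x - y) = cx x - cx y := by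
  ext; simp

theorem cx_smul (t : ℝ) (x : EuclideanSpace ℝ (Fin n)) : cx (t • x) = (t : ℂ) • cx x := by
  ext; simp

theorem cx_single (i : Fin n) : cx (EuclideanSpace.single i (1 : ℝ)) = Pi.single i (1 : ℂ) := by
  ext j
  by_cases h : j = i
  · subst h; simp
  · simp [h]

@[fun_prop]
theorem continuous_cx : Continuous (cx : EuclideanSpace ℝ (Fin n) → Fin n → ℂ) := by
  unfold cx; fun_prop

theorem norm_cx_le (x : EuclideanSpace ℝ (Fin n)) : ‖cx x‖ ≤ ‖x‖ := by
  refine (pi_norm_le_iff_of_nonneg (norm_nonneg _)).2 fun j => ?_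
  simpa using PiLp.norm_apply_le x j

@[fun_prop]
theorem continuous_eval (P : MvPolynomial (Fin n) ℂ) : Continuous fun z : Fin n → ℂ => eval z P :=
  MvPolynomial.continuous_eval P

theorem hasDerivAt_eval (P : MvPolynomial (Fin n) ℂ) (z v : Fin n → ℂ) (w : ℂ) :
    HasDerivAt (fun w : ℂ => eval (z + w • v) P)
      (∑ i, v i * eval (z + w • v) (pderiv i P)) w := by
  induction P using MvPolynomial.induction_on with
  | C a => simpa using hasDerivAt_const w a
  | add P Q hP hQ =>
    simp only [map_add, mul_add, Finset.sum_add_distrib]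
    exact hP.add hQ
  | mul_X P i hP =>
    have h : HasDerivAt (fun w : ℂ => (z + w • v) i) (v i) w := by
      simpa using ((hasDerivAt_id w).mul_const (v i)).const_add (z i)
    have := hP.mul h
    simp only [map_mul, eval_X, Derivation.leibniz, smul_eq_mul, pderiv_X, map_add]
    convert! this using 1
    simp only [mul_add, Finset.sum_add_distrib, Finset.sum_mul]
    rw [add_comm]
    congr 1
    · refine Finset.sum_congr rfl fun j _ => ?_; ring
    · rw [Finset.sum_eq_single i]
      · simp; ring
      · intro j _ hj; simp [hj.symm]
      · simp

theorem differentiable_eval_comp (P : MvPolynomial (Fin n) ℂ) {g : ℂ → Fin n → ℂ}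
    (hg : ∀ i, Differentiable ℂ fun s => g s i) : Differentiable ℂ fun s => eval (g s) P := by
  induction P using MvPolynomial.induction_on with
  | C a => simp
  | add P Q hP hQ => simp only [map_add]; exact hP.add hQ
  | mul_X P i hP => simp only [map_mul, eval_X]; exact hP.mul (hg i)

theorem hasDerivAt_eval_single (P : MvPolynomial (Fin n) ℂ) (z : Fin n → ℂ) (i : Fin n) (w : ℂ) :
    HasDerivAt (fun w : ℂ => eval (z + w • Pi.single i (1 : ℂ)) P)
      (eval (z + w • Pi.single i (1 : ℂ)) (pderiv i P)) w := by
  convert! hasDerivAt_eval P z (Pi.single i 1) w using 1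
  rw [Finset.sum_eq_single i]
  · simp
  · intro j _ hj; simp [hj]
  · simp

theorem hasDerivAt_eval_cx (P : MvPolynomial (Fin n) ℂ) (x : EuclideanSpace ℝ (Fin n)) (i : Fin n)
    (t : ℝ) :
    HasDerivAt (fun t : ℝ => eval (cx (x + t • EuclideanSpace.single i (1 : ℝ))) P)
      (eval (cx (x + t • EuclideanSpace.single i (1 : ℝ))) (pderiv i P)) t := by
  have := (hasDerivAt_eval_single P (cx x) i (t : ℂ)).comp_ofReal
  simpa only [cx_add, cx_smul, cx_single] using this

/-! ### Homogeneity, conjugation and the Laplacian of polynomials -/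

theorem eval_smul_of_isHomogeneous {P : MvPolynomial (Fin n) ℂ} {k : ℕ} (hP : P.IsHomogeneous k)
    (c : ℂ) (z : Fin n → ℂ) : eval (c • z) P = c ^ k * eval z P := by
  rw [eval_eq, eval_eq, Finset.mul_sum]
  refine Finset.sum_congr rfl fun d hd => ?_
  simp only [Pi.smul_apply, smul_eq_mul, mul_pow, Finset.prod_mul_distrib]
  rw [Finset.prod_pow_eq_pow_sum, ← hP.degree_eq_sum_deg_support hd]
  ring

/-- The conjugate polynomial. -/
def conjPoly (P : MvPolynomial (Fin n) ℂ) : MvPolynomial (Fin n) ℂ := map (starRingEnd ℂ) P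

theorem eval_conjPoly (P : MvPolynomial (Fin n) ℂ) (x : EuclideanSpace ℝ (Fin n)) :
    eval (cx x) (conjPoly P) = conj (eval (cx x) P) := by
  rw [conjPoly, eval_map, ← eval₂_id, ← coe_eval₂Hom, ← coe_eval₂Hom, ← RingHom.comp_apply]
  congr 1
  ext <;> simp

/-- The Laplacian of a polynomial. -/
def polyLap : MvPolynomial (Fin n) ℂ →ₗ[ℂ] MvPolynomial (Fin n) ℂ :=
  ∑ i, (pderiv i).toLinearMap ∘ₗ (pderiv i).toLinearMap

theorem polyLap_apply (P : MvPolynomial (Fin n) ℂ) :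
    polyLap P = ∑ i, pderiv i (pderiv i P) := by
  simp [polyLap]

theorem polyLap_isHomogeneous {P : MvPolynomial (Fin n) ℂ} {k : ℕ} (hP : P.IsHomogeneous k) :
    (polyLap P).IsHomogeneous (k - 2) := by
  rw [polyLap_apply]
  exact IsHomogeneous.sum _ _ _ fun i _ => hP.pderiv.pderiv

theorem polyLap_eq_zero {P : MvPolynomial (Fin n) ℂ} {k : ℕ} (hP : P.IsHomogeneous k)
    (hk : k < 2) : polyLap P = 0 := by
  rw [polyLap_apply]
  refine Finset.sum_eq_zero fun i _ => ?_
  have h : (pderiv i P).IsHomogeneous 0 := by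
    have := hP.pderiv (i := i)
    rwa [show k - 1 = 0 by omega] at this
  rw [← totalDegree_zero_iff_isHomogeneous, totalDegree_eq_zero_iff_eq_C] at h
  rw [h, pderiv_C]

theorem polyLap_conjPoly (P : MvPolynomial (Fin n) ℂ) :
    polyLap (conjPoly P) = conjPoly (polyLap P) := by
  simp [polyLap_apply, conjPoly, pderiv_map]

theorem polyLap_iterate_conjPoly (p : ℕ) (P : MvPolynomial (Fin n) ℂ) :
    polyLap^[p] (conjPoly P) = conjPoly (polyLap^[p] P) :=
  ((Function.Commute.iterate_left (f := polyLap) (g := conjPoly)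
    (fun P => polyLap_conjPoly P)) p).eq P

/-! ### Weighted integrals of polynomials over the ball -/

/-- The radial weight `(1 - |x|²)₊ ^ m`. -/
def weight (m : ℕ) (x : EuclideanSpace ℝ (Fin n)) : ℝ := max 0 (1 - ‖x‖ ^ 2) ^ m

@[fun_prop]
theorem continuous_weight (m : ℕ) : Continuous (weight (n := n) m) := by
  unfold weight; fun_prop

theorem weight_nonneg (m : ℕ) (x : EuclideanSpace ℝ (Fin n)) : 0 ≤ weight m x := by
  unfold weight; positivity

theorem weight_le_one (m : ℕ) (x : EuclideanSpace ℝ (Fin n)) : weight m x ≤ 1 := by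
  refine pow_le_one₀ (le_max_left _ _) (max_le zero_le_one ?_)
  nlinarith [sq_nonneg ‖x‖]

theorem weight_eq_zero {m : ℕ} (hm : m ≠ 0) {x : EuclideanSpace ℝ (Fin n)} (hx : 1 ≤ ‖x‖) :
    weight m x = 0 := by
  have : 1 - ‖x‖ ^ 2 ≤ 0 := by nlinarith
  simp [weight, this, hm]

theorem integrable_weight {m : ℕ} (hm : m ≠ 0) {F : EuclideanSpace ℝ (Fin n) → ℂ}
    (hF : Continuous F) : Integrable fun x => (weight m x : ℂ) * F x := by
  refine Continuous.integrable_of_hasCompactSupport (by fun_prop) ?_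
  refine HasCompactSupport.intro (isCompact_closedBall (0 : EuclideanSpace ℝ (Fin n)) 1)
    fun x hx => ?_
  rw [weight_eq_zero hm]
  · simp
  · simp only [mem_closedBall, dist_zero_right, not_le] at hx; exact hx.le

/-- The truncated power stays differentiable at 0 because its exponent is at least 2: there it is
`O(|t| ^ (m + 1))`. This permits integration by parts over the whole space, without boundary terms.
-/
theorem hasDerivAt_max_pow {m : ℕ} (hm : m ≠ 0) (t : ℝ) :
    HasDerivAt (fun t : ℝ => max 0 t ^ (m + 1)) ((m + 1) * max 0 t ^ m) t := by
  rcases lt_trichotomy t 0 with ht | rfl | ht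
  · rw [max_eq_left ht.le, zero_pow hm, mul_zero]
    refine (hasDerivAt_const t (0 : ℝ)).congr_of_eventuallyEq ?_
    filter_upwards [gt_mem_nhds ht] with s hs
    simp [max_eq_left hs.le]
  · rw [max_self, zero_pow hm, mul_zero]
    have h : (fun t : ℝ => max 0 t ^ (m + 1)) =O[𝓝 0] fun t => ‖t - 0‖ ^ (m + 1) := by
      refine Asymptotics.IsBigO.of_norm_le fun s => ?_
      simp only [norm_pow, sub_zero, Real.norm_eq_abs]
      refine pow_le_pow_left₀ (abs_nonneg _) ?_ _
      rw [abs_of_nonneg (le_max_left _ _)]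
      exact max_le (abs_nonneg _) (le_abs_self _)
    have := h.hasFDerivAt (𝕜 := ℝ) (by omega)
    simpa using this.hasDerivAt
  · rw [max_eq_right ht.le]
    have h := hasDerivAt_pow (m + 1) t
    simp only [Nat.cast_add, Nat.cast_one, Nat.add_sub_cancel] at h
    refine h.congr_of_eventuallyEq ?_
    filter_upwards [lt_mem_nhds ht] with s hs
    simp [max_eq_right hs.le]

theorem hasLineDerivAt_weight {m : ℕ} (hm : m ≠ 0) (x : EuclideanSpace ℝ (Fin n)) (i : Fin n) :
    HasLineDerivAt ℝ (fun x => (weight (m + 1) x : ℂ)) (-(2 * (m + 1)) * (weight m x * (x i : ℂ)))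
      x (EuclideanSpace.single i (1 : ℝ)) := by
  have h1 : HasFDerivAt (fun x : EuclideanSpace ℝ (Fin n) => 1 - ‖x‖ ^ 2) (-(2 • innerSL ℝ x)) x :=
    (hasStrictFDerivAt_norm_sq x).hasFDerivAt.const_sub 1
  have h2 : HasFDerivAt (weight (m + 1))
      (((m + 1 : ℝ) * weight m x) • (-(2 • innerSL ℝ x) : EuclideanSpace ℝ (Fin n) →L[ℝ] ℝ)) x :=
    HasDerivAt.comp_hasFDerivAt x (f := fun x : EuclideanSpace ℝ (Fin n) => 1 - ‖x‖ ^ 2)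
      (hasDerivAt_max_pow hm (1 - ‖x‖ ^ 2)) h1
  have h3 := (Complex.ofRealCLM.hasFDerivAt.comp x h2).hasLineDerivAt
    (EuclideanSpace.single i (1 : ℝ))
  convert! h3 using 1
  simp [EuclideanSpace.inner_single_right]
  ring

/-- The integral of a polynomial against the weight `(1 - |x|²)₊ ^ (m + 1)`. -/
def wint (m : ℕ) : MvPolynomial (Fin n) ℂ →ₗ[ℂ] ℂ where
  -- The exponent `m + 1` is positive, so the weight is continuous with compact support and every
  -- polynomial is integrable against it.
  toFun P := ∫ x : EuclideanSpace ℝ (Fin n), (weight (m + 1) x : ℂ) * eval (cx x) P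
  map_add' P Q := by
    simp only [map_add, mul_add]
    exact integral_add (integrable_weight (by omega) (by fun_prop))
      (integrable_weight (by omega) (by fun_prop))
  map_smul' c P := by
    simp only [smul_eval, RingHom.id_apply, smul_eq_mul, mul_left_comm _ c]
    exact integral_const_mul _ _

theorem wint_apply (m : ℕ) (P : MvPolynomial (Fin n) ℂ) :
    wint m P = ∫ x : EuclideanSpace ℝ (Fin n), (weight (m + 1) x : ℂ) * eval (cx x) P := rfl

/-- Integration by parts: the `i`-th derivative of `(1 - |x|²)₊ ^ (m + 2)` is `-2 (m + 2) x_i (1 -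
|x|²)₊ ^ (m + 1)`. -/
theorem wint_pderiv (m : ℕ) (P : MvPolynomial (Fin n) ℂ) (i : Fin n) :
    wint (m + 1) (pderiv i P) = 2 * (m + 2) * wint m (X i * P) := by
  have h := integral_bilinear_hasLineDerivAt_right_eq_neg_left_of_integrable
    (μ := (volume : Measure (EuclideanSpace ℝ (Fin n)))) (B := ContinuousLinearMap.mul ℝ ℂ)
    (f := fun x => (weight (m + 1 + 1) x : ℂ))
    (f' := fun x => -(2 * ((m + 1 : ℕ) + 1)) * (weight (m + 1) x * (x i : ℂ)))
    (g := fun x => eval (cx x) P) (g' := fun x => eval (cx x) (pderiv i P))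
    (v := EuclideanSpace.single i (1 : ℝ)) ?_ ?_ ?_
    (fun x _ => hasLineDerivAt_weight (by omega) x i) (fun x _ => ?_)
  · simp only [ContinuousLinearMap.mul_apply'] at h
    rw [wint_apply, h, wint_apply, ← integral_neg, ← integral_const_mul]
    refine integral_congr_ae (Eventually.of_forall fun x => ?_)
    simp
    ring
  · simp only [ContinuousLinearMap.mul_apply']
    have := integrable_weight (m := m + 1) (by omega)
      (F := fun x : EuclideanSpace ℝ (Fin n) =>
        -(2 * ((m + 1 : ℕ) + 1)) * ((x i : ℂ) * eval (cx x) P)) (by fun_prop)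
    refine this.congr (Eventually.of_forall fun x => ?_)
    simp only
    ring
  · exact integrable_weight (by omega) (by fun_prop)
  · exact integrable_weight (by omega) (by fun_prop)
  · have := hasDerivAt_eval_cx P x i 0
    simpa [HasLineDerivAt] using this

/-- `f Δg - g Δf` is the divergence of `f ∇g - g ∇f`. Integrating by parts lowers the exponent of
the weight by one and replaces the divergence by the product with `x`, which Euler's relation turns
into `(k - j) f g`. -/
theorem wint_green (m : ℕ) {f g : MvPolynomial (Fin n) ℂ} {j k : ℕ} (hf : f.IsHomogeneous j)
    (hg : g.IsHomogeneous k) :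
    wint (m + 1) (f * polyLap g) - wint (m + 1) (polyLap f * g) =
      2 * (m + 2) * ((k : ℂ) - j) * wint m (f * g) := by
  have h : f * polyLap g - polyLap f * g
      = ∑ i, pderiv i (f * pderiv i g - pderiv i f * g) := by
    simp only [polyLap_apply, Finset.mul_sum, Finset.sum_mul, ← Finset.sum_sub_distrib, map_sub,
      Derivation.leibniz, smul_eq_mul]
    refine Finset.sum_congr rfl fun i _ => ?_
    ring
  rw [← map_sub, h, map_sum]
  simp only [wint_pderiv]
  rw [← Finset.mul_sum, ← map_sum]
  have h2 : ∑ i, X i * (f * pderiv i g - pderiv i f * g) = ((k : ℂ) - j) • (f * g) := by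
    have e1 := hf.sum_X_mul_pderiv
    have e2 := hg.sum_X_mul_pderiv
    have : ∑ i, X i * (f * pderiv i g - pderiv i f * g)
        = f * (∑ i, X i * pderiv i g) - (∑ i, X i * pderiv i f) * g := by
      simp only [Finset.mul_sum, Finset.sum_mul, ← Finset.sum_sub_distrib]
      refine Finset.sum_congr rfl fun i _ => ?_
      ring
    rw [this, e1, e2, sub_smul, nsmul_eq_mul, nsmul_eq_mul, Nat.cast_smul_eq_nsmul,
      Nat.cast_smul_eq_nsmul, nsmul_eq_mul, nsmul_eq_mul]
    ring
  rw [h2, map_smul, smul_eq_mul]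
  ring

/-- Induction on `N` through `wint_green`. A Laplacian lowers `a` or `b` by one and narrows the gap
between the degrees by at most two, so both terms on the left vanish by induction, while the factor
`k - j` on the right is nonzero. The identity raises the exponent of the weight, hence the statement
for all `m`. -/
theorem wint_mul_eq_zero {N : ℕ} {a b : ℕ} (hab : a + b ≤ N) (m : ℕ) {f g : MvPolynomial (Fin n) ℂ}
    {j k : ℕ} (hf : f.IsHomogeneous j) (hg : g.IsHomogeneous k) (hfa : polyLap^[a] f = 0)
    (hgb : polyLap^[b] g = 0) (hjk : 2 * (N : ℤ) ≤ |(j : ℤ) - k|) : wint m (f * g) = 0 := by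
  induction N generalizing a b m f g j k with
  | zero =>
    obtain rfl : a = 0 := by omega
    rw [Function.iterate_zero, id] at hfa
    simp [hfa]
  | succ N ih =>
    rcases a with _ | a
    · rw [Function.iterate_zero, id] at hfa
      simp [hfa]
    rcases b with _ | b
    · rw [Function.iterate_zero, id] at hgb
      simp [hgb]
    have h := wint_green m hf hg
    have h1 : wint (m + 1) (f * polyLap g) = 0 := by
      -- For `k < 2` the truncated degree `k - 2` would be meaningless for the gap, but there the
      -- Laplacian is zero.
      by_cases hk : k < 2
      · simp [polyLap_eq_zero hg hk]
      · refine ih (a := a + 1) (b := b) (by omega) (m + 1) hf (polyLap_isHomogeneous hg) hfa hgb ?_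
        rw [le_abs] at hjk ⊢; omega
    have h2 : wint (m + 1) (polyLap f * g) = 0 := by
      by_cases hk : j < 2
      · simp [polyLap_eq_zero hf hk]
      · refine ih (a := a) (b := b + 1) (by omega) (m + 1) (polyLap_isHomogeneous hf) hg hfa hgb ?_
        rw [le_abs] at hjk ⊢; omega
    rw [h1, h2, sub_zero, eq_comm, mul_eq_zero, mul_eq_zero] at h
    rcases h with (h | h) | h
    · exfalso
      have : (2 * ((m : ℂ) + 2)) = ((2 * (m + 2) : ℕ) : ℂ) := by push_cast; ring
      rw [this] at h
      exact absurd (Nat.cast_eq_zero.1 h) (by omega)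
    · exfalso
      rw [sub_eq_zero] at h
      have h' : k = j := by exact_mod_cast h
      rw [h', sub_self, abs_zero] at hjk
      push_cast at hjk
      omega
    · exact h

end Polynomials

section LocalSums

variable {n : ℕ}

/-! ### Functions that are sums of series of polynomials near the origin -/

/-- `F` is near the origin of `ℝⁿ` the sum of the polynomials `Q k`, and the series converges
geometrically on a complex neighbourhood of the origin. -/
def IsLocalSum (F : EuclideanSpace ℝ (Fin n) → ℂ) (Q : ℕ → MvPolynomial (Fin n) ℂ) : Prop :=
  ∃ ρ C : ℝ, 0 < ρ ∧ (∀ k z, ‖z‖ ≤ ρ → ‖eval z (Q k)‖ ≤ C * (1 / 2) ^ k) ∧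
    ∀ h : EuclideanSpace ℝ (Fin n), ‖h‖ ≤ ρ → HasSum (fun k => eval (cx h) (Q k)) (F h)

theorem summable_half (C : ℝ) : Summable fun k : ℕ => C * (1 / 2 : ℝ) ^ k :=
  (summable_geometric_of_lt_one (by norm_num) (by norm_num)).mul_left C

theorem IsLocalSum.congr {F G : EuclideanSpace ℝ (Fin n) → ℂ} {Q : ℕ → MvPolynomial (Fin n) ℂ}
    (h : IsLocalSum F Q) (hFG : F =ᶠ[𝓝 0] G) : IsLocalSum G Q := by
  obtain ⟨ρ, C, hρ, h1, h2⟩ := h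
  obtain ⟨δ, hδ, hδ'⟩ := Metric.eventually_nhds_iff_ball.1 hFG
  refine ⟨min ρ (δ / 2), C, lt_min hρ (by positivity),
    fun k z hz => h1 k z (hz.trans (min_le_left _ _)), fun x hx => ?_⟩
  rw [← hδ' x]
  · exact h2 x (hx.trans (min_le_left _ _))
  · rw [mem_ball_zero_iff]
    linarith [hx.trans (min_le_right _ _)]

theorem IsLocalSum.add {F G : EuclideanSpace ℝ (Fin n) → ℂ} {P Q : ℕ → MvPolynomial (Fin n) ℂ}
    (hF : IsLocalSum F P) (hG : IsLocalSum G Q) : IsLocalSum (F + G) fun k => P k + Q k := by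
  obtain ⟨ρ, C, hρ, h1, h2⟩ := hF
  obtain ⟨ρ', C', hρ', h1', h2'⟩ := hG
  refine ⟨min ρ ρ', C + C', lt_min hρ hρ', fun k z hz => ?_, fun x hx => ?_⟩
  · rw [map_add, add_mul]
    exact norm_add_le_of_le (h1 k z (hz.trans (min_le_left _ _)))
      (h1' k z (hz.trans (min_le_right _ _)))
  · simpa using (h2 x (hx.trans (min_le_left _ _))).add (h2' x (hx.trans (min_le_right _ _)))

theorem IsLocalSum.const_smul {F : EuclideanSpace ℝ (Fin n) → ℂ} {P : ℕ → MvPolynomial (Fin n) ℂ}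
    (hF : IsLocalSum F P) (a : ℂ) : IsLocalSum (a • F) fun k => a • P k := by
  obtain ⟨ρ, C, hρ, h1, h2⟩ := hF
  refine ⟨ρ, ‖a‖ * C, hρ, fun k z hz => ?_, fun x hx => ?_⟩
  · rw [smul_eval, norm_mul, mul_assoc]
    exact mul_le_mul_of_nonneg_left (h1 k z hz) (norm_nonneg _)
  · simpa using (h2 x hx).mul_left a

theorem IsLocalSum.zero : IsLocalSum (0 : EuclideanSpace ℝ (Fin n) → ℂ) fun _ => 0 :=
  ⟨1, 0, one_pos, by simp, by simp [hasSum_zero]⟩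

theorem IsLocalSum.finset_sum {ι : Type*} (s : Finset ι) {F : ι → EuclideanSpace ℝ (Fin n) → ℂ}
    {Q : ι → ℕ → MvPolynomial (Fin n) ℂ} (h : ∀ i ∈ s, IsLocalSum (F i) (Q i)) :
    IsLocalSum (∑ i ∈ s, F i) fun k => ∑ i ∈ s, Q i k := by
  classical
  induction s using Finset.induction_on with
  | empty => simpa using IsLocalSum.zero
  | insert a s ha ih =>
    simp only [Finset.sum_insert ha]
    exact (h a (Finset.mem_insert_self _ _)).add
      (ih fun i hi => h i (Finset.mem_insert_of_mem hi))

/-- Cauchy's estimate on a circle of radius `r` in the `i`-th coordinate. It needs bounds at complex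
points, which is why `IsLocalSum` contains them. -/
theorem norm_eval_pderiv_le {Q : MvPolynomial (Fin n) ℂ} {r M : ℝ} (hr : 0 < r) {z : Fin n → ℂ}
    (h : ∀ w, ‖w‖ ≤ ‖z‖ + r → ‖eval w Q‖ ≤ M) (i : Fin n) : ‖eval z (pderiv i Q)‖ ≤ M / r := by
  have hd := hasDerivAt_eval_single Q z i 0
  rw [zero_smul, add_zero] at hd
  rw [← hd.deriv]
  refine Complex.norm_deriv_le_of_forall_mem_sphere_norm_le hr ?_ fun w hw => h _ ?_
  · exact (show Differentiable ℂ _ from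
      fun w => (hasDerivAt_eval_single Q z i w).differentiableAt).diffContOnCl
  · refine (norm_add_le _ _).trans ?_
    rw [mem_sphere_zero_iff_norm] at hw
    rw [norm_smul, hw, Pi.norm_single]
    simp

/-- On half the polydisc Cauchy's estimate keeps the geometric bound, with a larger constant, so the
differentiated series converges uniformly and may be summed termwise. -/
theorem IsLocalSum.lineDeriv {F : EuclideanSpace ℝ (Fin n) → ℂ} {Q : ℕ → MvPolynomial (Fin n) ℂ}
    (h : IsLocalSum F Q) (i : Fin n) :
    ∃ G : EuclideanSpace ℝ (Fin n) → ℂ, IsLocalSum G (fun k => pderiv i (Q k)) ∧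
      ∀ᶠ x in 𝓝 0, HasLineDerivAt ℝ F (G x) x (EuclideanSpace.single i 1) := by
  obtain ⟨ρ, C, hρ, h1, h2⟩ := h
  have hb : ∀ k z, ‖z‖ ≤ ρ / 2 → ‖eval z (pderiv i (Q k))‖ ≤ C / (ρ / 2) * (1 / 2) ^ k := by
    intro k z hz
    refine (norm_eval_pderiv_le (r := ρ / 2) (by positivity)
      (fun w hw => h1 k w (by linarith)) i).trans_eq ?_
    ring
  refine ⟨fun x => ∑' k, eval (cx x) (pderiv i (Q k)),
    ⟨ρ / 2, C / (ρ / 2), by positivity, hb, fun x hx => ?_⟩, ?_⟩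
  · exact (Summable.of_norm_bounded (summable_half _)
      fun k => hb k _ ((norm_cx_le x).trans hx)).hasSum
  · have : ∀ᶠ x : EuclideanSpace ℝ (Fin n) in 𝓝 0, ‖x‖ < ρ / 4 :=
      (continuous_norm.tendsto' _ _ norm_zero).eventually (gt_mem_nhds (by positivity))
    filter_upwards [this] with x hx
    have hn : ∀ t ∈ ball (0 : ℝ) (ρ / 4), ‖x + t • EuclideanSpace.single i (1 : ℝ)‖ ≤ ρ / 2 := by
      intro t ht
      rw [mem_ball_zero_iff] at ht
      refine (norm_add_le _ _).trans ?_
      rw [norm_smul, PiLp.norm_single]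
      simp only [norm_one, mul_one]
      linarith
    have hd := hasDerivAt_tsum_of_isPreconnected (summable_half (C / (ρ / 2))) isOpen_ball
      (convex_ball (0 : ℝ) (ρ / 4)).isPreconnected
      (g := fun k (t : ℝ) => eval (cx (x + t • EuclideanSpace.single i (1 : ℝ))) (Q k))
      (fun k t _ => hasDerivAt_eval_cx (Q k) x i t)
      (fun k t ht => hb k _ ((norm_cx_le _).trans (hn t ht)))
      (mem_ball_self (by positivity))
      (h2 _ ((hn 0 (mem_ball_self (by positivity))).trans (by linarith))).summable
      (mem_ball_self (by positivity))
    rw [zero_smul, add_zero] at hd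
    refine hd.congr_of_eventuallyEq ?_
    filter_upwards [ball_mem_nhds (0 : ℝ) (show 0 < ρ / 4 by positivity)] with t ht
    exact (h2 _ ((hn t ht).trans (by linarith))).tsum_eq.symm

theorem laplacian_eq_sum (u : EuclideanSpace ℝ (Fin n) → ℂ) (x : EuclideanSpace ℝ (Fin n)) :
    Laplacian.laplacian u x = ∑ i, fderiv ℝ (fderiv ℝ u) x (EuclideanSpace.single i 1)
      (EuclideanSpace.single i 1) := by
  rw [InnerProductSpace.laplacian_eq_iteratedFDeriv_orthonormalBasis u
    (EuclideanSpace.basisFun (Fin n) ℝ)]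
  simp [iteratedFDeriv_two_apply]

theorem IsLocalSum.laplacian {u : EuclideanSpace ℝ (Fin n) → ℂ} {Q : ℕ → MvPolynomial (Fin n) ℂ}
    (hu : AnalyticAt ℝ u 0) (h : IsLocalSum u Q) :
    IsLocalSum (Laplacian.laplacian u) fun k => polyLap (Q k) := by
  simp only [polyLap_apply]
  choose G hG hGu using fun i => h.lineDeriv i
  choose H hH hHG using fun i => (hG i).lineDeriv i
  refine (IsLocalSum.finset_sum Finset.univ fun i _ => hH i).congr ?_
  -- `G i` must equal the partial derivative of `u` on a whole neighbourhood of `x`, so that its own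
  -- line derivative is a second derivative of `u`.
  have h1 : ∀ᶠ x in 𝓝 0, ∀ i, (fun y => fderiv ℝ u y (EuclideanSpace.single i 1)) =ᶠ[𝓝 x] G i := by
    refine eventually_all.2 fun i => eventually_eventually_nhds.2 ?_
    filter_upwards [hu.eventually_analyticAt, hGu i] with y hy hy'
    exact (hy.differentiableAt.hasFDerivAt.hasLineDerivAt _).unique hy'
  filter_upwards [h1, hu.eventually_analyticAt, eventually_all.2 hHG] with x hx hux hHx
  rw [laplacian_eq_sum, Finset.sum_apply]
  refine Finset.sum_congr rfl fun i _ => ?_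
  have e1 : HasFDerivAt (fun y => fderiv ℝ u y (EuclideanSpace.single i 1))
      ((ContinuousLinearMap.apply ℝ ℂ (EuclideanSpace.single i (1 : ℝ))).comp
        (fderiv ℝ (fderiv ℝ u) x)) x :=
    ((ContinuousLinearMap.apply ℝ ℂ (EuclideanSpace.single i (1 : ℝ))).hasFDerivAt).comp x
      hux.fderiv.differentiableAt.hasFDerivAt
  have e2 := (e1.hasLineDerivAt (EuclideanSpace.single i 1)).congr_of_eventuallyEq (hx i).symm
  exact (hHx i).unique e2

theorem IsLocalSum.laplacian_iterate {u : EuclideanSpace ℝ (Fin n) → ℂ}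
    {Q : ℕ → MvPolynomial (Fin n) ℂ} {G : Set (EuclideanSpace ℝ (Fin n))} (h0 : 0 ∈ G)
    (hu : AnalyticOnNhd ℝ u G) (h : IsLocalSum u Q) (p : ℕ) :
    IsLocalSum (Laplacian.laplacian^[p] u) (fun k => polyLap^[p] (Q k)) := by
  induction p generalizing u Q with
  | zero => exact h
  | succ p ih =>
    simp only [Function.iterate_succ_apply]
    exact ih (analyticOnNhd_laplacian hu) (h.laplacian (hu 0 h0))

/-! ### Homogeneous components of polyharmonic functions -/

theorem eq_zero_of_hasSum_pow {a : ℕ → ℂ}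
    (h : ∀ᶠ t : ℝ in 𝓝 0, HasSum (fun k => (t : ℂ) ^ k * a k) 0) : a = 0 := by
  let p : FormalMultilinearSeries ℝ ℝ ℂ := fun k => ContinuousMultilinearMap.mkPiRing ℝ (Fin k) (a k)
  have hp : ∀ k, p.coeff k = a k := fun k => by simp [p, FormalMultilinearSeries.coeff]
  have h0 : HasFPowerSeriesAt (0 : ℝ → ℂ) p 0 := by
    rw [hasFPowerSeriesAt_iff]
    filter_upwards [h] with t ht
    simpa [hp] using ht
  ext k
  rw [← hp, h0.eq_zero]
  rfl

theorem eq_zero_of_eval_cx {Q : MvPolynomial (Fin n) ℂ}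
    (h : ∀ x : EuclideanSpace ℝ (Fin n), eval (cx x) Q = 0) : Q = 0 := by
  refine MvPolynomial.funext_set (fun _ => Set.range ((↑) : ℝ → ℂ))
    (fun _ => Set.infinite_range_of_injective Complex.ofReal_injective) fun z hz => ?_
  choose x hx using fun i => hz i (Set.mem_univ i)
  rw [map_zero, ← h (WithLp.toLp 2 x)]
  congr 2
  ext i
  simp [hx]

/-- Along a ray `t x` the series is a power series in `t` with sum zero, so every component vanishes
at every real point. The shift `d` is meant for the iterated Laplacians of `P k`, of degree `k - 2 *
p`; they are zero where this subtraction truncates. -/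
theorem IsLocalSum.eq_zero_of_isHomogeneous {Q : ℕ → MvPolynomial (Fin n) ℂ} {d : ℕ}
    (h : IsLocalSum (0 : EuclideanSpace ℝ (Fin n) → ℂ) Q) (hQ : ∀ k, (Q k).IsHomogeneous (k - d))
    (hd : ∀ k < d, Q k = 0) (k : ℕ) : Q k = 0 := by
  obtain ⟨ρ, C, hρ, -, h2⟩ := h
  rcases lt_or_ge k d with hk | hk
  · exact hd k hk
  refine eq_zero_of_eval_cx fun x => ?_
  have h3 : (fun l => eval (cx x) (Q (l + d))) = 0 := by
    refine eq_zero_of_hasSum_pow ?_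
    have : ∀ᶠ t : ℝ in 𝓝 0, ‖t • x‖ < ρ :=
      (Continuous.tendsto' (by fun_prop) _ _ (by simp)).eventually (gt_mem_nhds hρ)
    filter_upwards [this] with t ht
    have h4 := h2 _ ht.le
    rw [Pi.zero_apply, ← hasSum_nat_add_iff' d] at h4
    rw [Finset.sum_eq_zero (fun i hi => by simp [hd i (Finset.mem_range.1 hi)]), sub_zero] at h4
    convert! h4 using 2 with l
    rw [cx_smul, eval_smul_of_isHomogeneous (hQ (l + d)), Nat.add_sub_cancel]
  have := congrFun h3 (k - d)
  simpa [Nat.sub_add_cancel hk] using this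

theorem polyLap_iterate_isHomogeneous {P : MvPolynomial (Fin n) ℂ} {k : ℕ} (hP : P.IsHomogeneous k)
    (p : ℕ) : (polyLap^[p] P).IsHomogeneous (k - 2 * p) := by
  induction p with
  | zero => simpa using hP
  | succ p ih =>
    rw [Function.iterate_succ_apply', show k - 2 * (p + 1) = k - 2 * p - 2 by omega]
    exact polyLap_isHomogeneous ih

theorem polyLap_iterate_eq_zero {P : MvPolynomial (Fin n) ℂ} {k : ℕ} (hP : P.IsHomogeneous k)
    {p : ℕ} (hk : k < 2 * p) : polyLap^[p] P = 0 := by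
  induction p with
  | zero => omega
  | succ p ih =>
    rw [Function.iterate_succ_apply']
    exact polyLap_eq_zero (polyLap_iterate_isHomogeneous hP p) (by omega)

/-- The homogeneous components at the origin of a polyharmonic function are polyharmonic, and
conversely. -/
theorem isPolyharmonicOn_iff {p : ℕ} {u : EuclideanSpace ℝ (Fin n) → ℂ}
    {P : ℕ → MvPolynomial (Fin n) ℂ} (hu : AnalyticOnNhd ℝ u (unitBall n)) (h : IsLocalSum u P)
    (hP : ∀ k, (P k).IsHomogeneous k) :
    IsPolyharmonicOn p u (unitBall n) ↔ ∀ k, polyLap^[p] (P k) = 0 := by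
  have h0 : (0 : EuclideanSpace ℝ (Fin n)) ∈ unitBall n := mem_ball_self one_pos
  have hs := h.laplacian_iterate h0 hu p
  constructor
  · intro hp
    refine (hs.congr ?_).eq_zero_of_isHomogeneous
      (fun k => polyLap_iterate_isHomogeneous (hP k) p) fun k hk => polyLap_iterate_eq_zero (hP k) hk
    filter_upwards [isOpen_ball.mem_nhds h0] with x hx
    exact hp.2 x hx
  · intro hp
    refine ⟨hu, ?_⟩
    have ha : AnalyticOnNhd ℝ (Laplacian.laplacian^[p] u) (unitBall n) := by
      clear hs hp
      induction p with
      | zero => exact hu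
      | succ p ih =>
        rw [Function.iterate_succ_apply']
        exact analyticOnNhd_laplacian ih
    -- The iterated Laplacian is analytic on the connected ball, so its vanishing near the origin
    -- suffices.
    refine ha.eqOn_zero_of_preconnected_of_eventuallyEq_zero
      (convex_ball _ _).isPreconnected h0 ?_
    obtain ⟨ρ, C, hρ, -, h2⟩ := hs
    filter_upwards [closedBall_mem_nhds (0 : EuclideanSpace ℝ (Fin n)) hρ] with x hx
    have := h2 x (by simpa using hx)
    simp only [hp, map_zero] at this
    exact this.unique hasSum_zero

/-- A real-analytic function is locally the sum of its homogeneous components. -/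
theorem exists_isLocalSum {u : EuclideanSpace ℝ (Fin n) → ℂ} {x₀ : EuclideanSpace ℝ (Fin n)}
    (hu : AnalyticAt ℝ u x₀) :
    ∃ P : ℕ → MvPolynomial (Fin n) ℂ, (∀ k, (P k).IsHomogeneous k) ∧
      IsLocalSum (fun h => u (x₀ + h)) P := by
  obtain ⟨p, r, hp⟩ := hu
  obtain ⟨s, hs0, hsr⟩ := ENNReal.lt_iff_exists_nnreal_btwn.1 hp.r_pos
  obtain ⟨C, -, hC⟩ := p.norm_mul_pow_le_of_lt_radius (hsr.trans_le hp.r_le)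
  have hs : (0 : ℝ) < s := by exact_mod_cast hs0
  let e : Fin n → EuclideanSpace ℝ (Fin n) := fun j => EuclideanSpace.single j 1
  -- The `k`-linear Taylor coefficient is expanded on the standard basis; its diagonal becomes a
  -- polynomial, which also makes sense at complex points.
  let P : ℕ → MvPolynomial (Fin n) ℂ := fun k =>
    ∑ f : Fin k → Fin n, MvPolynomial.C (p k (fun i => e (f i))) * ∏ i, X (f i)
  have hPev : ∀ k z, eval z (P k) = ∑ f : Fin k → Fin n, p k (fun i => e (f i)) * ∏ i, z (f i) := by
    intro k z
    simp [P]
  have hPh : ∀ k (h : EuclideanSpace ℝ (Fin n)), eval (cx h) (P k) = p k fun _ => h := by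
    intro k h
    have hh : h = ∑ j, h j • e j := by
      have := (EuclideanSpace.basisFun (Fin n) ℝ).sum_repr h
      simpa [e] using this.symm
    rw [hPev]
    conv_rhs => rw [hh]
    change _ = (p k).toMultilinearMap _
    rw [MultilinearMap.map_sum (p k).toMultilinearMap (fun (_ : Fin k) j => h j • e j)]
    refine Finset.sum_congr rfl fun f _ => ?_
    rw [MultilinearMap.map_smul_univ (p k).toMultilinearMap (fun i => h (f i)) fun i => e (f i)]
    simp [mul_comm]
  -- There are `n ^ k` products, each at most `‖p k‖ (s / (2 (n + 1))) ^ k`; since `‖p k‖ s ^ k ≤ C`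
  -- and `n / (n + 1) ≤ 1`, a factor `(1 / 2) ^ k` remains. The radius `s / 2` keeps real points
  -- inside the ball of convergence.
  refine ⟨P, fun k => ?_, min (s / (2 * (n + 1))) (s / 2), C, by positivity, fun k z hz => ?_,
    fun h hh => ?_⟩
  · refine IsHomogeneous.sum _ _ _ fun f _ => ?_
    have h1 : (∏ i, (X (f i) : MvPolynomial (Fin n) ℂ)).IsHomogeneous k := by
      simpa using IsHomogeneous.prod Finset.univ (fun i => (X (f i) : MvPolynomial (Fin n) ℂ))
        (fun _ => 1) fun i _ => isHomogeneous_X ℂ (f i)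
    simpa using (isHomogeneous_C (Fin n) (p k fun i => e (f i))).mul h1
  · have hz' : ‖z‖ ≤ s / (2 * (n + 1)) := hz.trans (min_le_left _ _)
    rw [hPev]
    have h1 : ∀ f ∈ (Finset.univ : Finset (Fin k → Fin n)),
        ‖p k (fun i => e (f i)) * ∏ i, z (f i)‖ ≤ ‖p k‖ * (s / (2 * (n + 1))) ^ k := by
      intro f _
      rw [norm_mul]
      refine mul_le_mul ?_ ?_ (norm_nonneg _) (norm_nonneg _)
      · refine ((p k).le_opNorm _).trans_eq ?_
        simp [e]
      · rw [norm_prod]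
        refine (Finset.prod_le_prod (fun i _ => norm_nonneg _) fun i _ =>
          (norm_le_pi_norm z (f i)).trans hz').trans_eq ?_
        simp [div_pow]
    refine (norm_sum_le_of_le _ h1).trans ?_
    have hC0 : 0 ≤ C := (by positivity : 0 ≤ ‖p k‖ * (s : ℝ) ^ k).trans (hC k)
    rw [Finset.sum_const, Finset.card_univ, Fintype.card_fun, Fintype.card_fin, Fintype.card_fin,
      nsmul_eq_mul]
    calc ((n ^ k : ℕ) : ℝ) * (‖p k‖ * (s / (2 * (n + 1))) ^ k)
        = (‖p k‖ * s ^ k) * ((n / (n + 1)) ^ k * (1 / 2) ^ k) := by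
          push_cast
          rw [← mul_pow, mul_left_comm, ← mul_pow, mul_assoc, ← mul_pow]
          congr 2
          field_simp
      _ ≤ C * (1 * (1 / 2) ^ k) := by
          refine mul_le_mul (hC k) ?_ (by positivity) hC0
          refine mul_le_mul_of_nonneg_right (pow_le_one₀ (by positivity) ?_) (by positivity)
          rw [div_le_one (by positivity)]
          linarith
      _ = C * (1 / 2) ^ k := by rw [one_mul]
  · simp only [hPh]
    refine hp.hasSum ?_
    have : ‖h‖ ≤ s / 2 := hh.trans (min_le_right _ _)
    rw [Metric.mem_eball, edist_zero_right]
    refine lt_trans ?_ hsr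
    rw [← ofReal_norm, ENNReal.ofReal_lt_coe_iff (norm_nonneg _)]
    linarith

end LocalSums

section Dilations

variable {n : ℕ}

/-! ### Analyticity of integrals of dilated functions -/

theorem Continuous.integrableOn_subset_closedBall {G : EuclideanSpace ℝ (Fin n) → ℂ}
    (hG : Continuous G) {A : Set (EuclideanSpace ℝ (Fin n))} (hA : A ⊆ closedBall 0 1) :
    IntegrableOn G A :=
  (hG.continuousOn.integrableOn_compact (isCompact_closedBall _ _)).mono_set hA

/-- Induction on `P` with `G` arbitrary: a factor `X i` contributes `s y_i - c_i`, and `G` absorbs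
`y_i`. No differentiation under the integral sign is needed. -/
theorem differentiable_integral_eval (P : MvPolynomial (Fin n) ℂ) (c : Fin n → ℂ)
    {A : Set (EuclideanSpace ℝ (Fin n))} (hA : A ⊆ closedBall 0 1)
    {G : EuclideanSpace ℝ (Fin n) → ℂ} (hG : Continuous G) :
    Differentiable ℂ fun s : ℂ => ∫ y in A, eval (s • cx y - c) P * G y := by
  induction P using MvPolynomial.induction_on generalizing G with
  | C a => simp
  | add P Q hP hQ =>
    have : (fun s : ℂ => ∫ y in A, eval (s • cx y - c) (P + Q) * G y)
        = (fun s : ℂ => ∫ y in A, eval (s • cx y - c) P * G y) +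
          fun s : ℂ => ∫ y in A, eval (s • cx y - c) Q * G y := by
      ext s
      simp only [map_add, add_mul, Pi.add_apply]
      exact integral_add (Continuous.integrableOn_subset_closedBall (by fun_prop) hA)
        (Continuous.integrableOn_subset_closedBall (by fun_prop) hA)
    rw [this]
    exact (hP hG).add (hQ hG)
  | mul_X P i hP =>
    have : (fun s : ℂ => ∫ y in A, eval (s • cx y - c) (P * X i) * G y)
        = (fun s : ℂ => s * ∫ y in A, eval (s • cx y - c) P * (cx y i * G y)) -
          fun s : ℂ => c i * ∫ y in A, eval (s • cx y - c) P * G y := by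
      ext s
      simp only [Pi.sub_apply]
      rw [← integral_const_mul, ← integral_const_mul, ← integral_sub
        (Continuous.integrableOn_subset_closedBall (by fun_prop) hA)
        (Continuous.integrableOn_subset_closedBall (by fun_prop) hA)]
      refine integral_congr_ae (Eventually.of_forall fun y => ?_)
      simp
      ring
    rw [this]
    exact (differentiable_id.mul (hP (by fun_prop))).sub ((hP hG).const_mul (c i))

theorem integrableOn_dilation {u G : EuclideanSpace ℝ (Fin n) → ℂ}
    (hu : ContinuousOn u (ball 0 1)) (hG : Continuous G) {s : ℝ} (hs : |s| < 1)
    {A : Set (EuclideanSpace ℝ (Fin n))} (hA : A ⊆ closedBall 0 1) :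
    IntegrableOn (fun y => u (s • y) * G y) A := by
  refine (ContinuousOn.integrableOn_compact (isCompact_closedBall _ 1) ?_).mono_set hA
  refine (hu.comp (by fun_prop) fun y hy => ?_).mul hG.continuousOn
  rw [mem_closedBall_zero_iff] at hy
  rw [mem_ball_zero_iff, norm_smul, Real.norm_eq_abs]
  nlinarith [abs_nonneg s, norm_nonneg y]

theorem AnalyticAt.comp_ofReal {H : ℂ → ℂ} {s : ℝ} (h : AnalyticAt ℂ H s) :
    AnalyticAt ℝ (fun t : ℝ => H t) s :=
  (h.restrictScalars (𝕜 := ℝ)).comp (Complex.ofRealCLM.analyticAt s)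

/-- For `y` near `y₀` and complex `s` near `s₀`, the point `s y` stays where the polynomial series
of `u` at `s₀ y₀` converges geometrically. The integral thus extends to a uniform limit of entire
functions of `s`. -/
theorem analyticAt_integral_dilation_local {u G : EuclideanSpace ℝ (Fin n) → ℂ}
    (hG : Continuous G) {s₀ : ℝ} (hs : |s₀| < 1) {y₀ : EuclideanSpace ℝ (Fin n)}
    (hu : AnalyticAt ℝ u (s₀ • y₀)) :
    ∃ δ > 0, ∀ A : Set (EuclideanSpace ℝ (Fin n)), MeasurableSet A → A ⊆ closedBall 0 1 →
      A ⊆ ball y₀ δ → AnalyticAt ℝ (fun s : ℝ => ∫ y in A, u (s • y) * G y) s₀ := by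
  obtain ⟨P, -, ρ, C, hρ, h1, h2⟩ := exists_isLocalSum hu
  refine ⟨ρ / 2, by positivity, fun A hAm hA1 hA2 => ?_⟩
  have hA : ∀ y ∈ A, ‖y‖ ≤ 1 ∧ ‖y - y₀‖ ≤ ρ / 2 := fun y hy =>
    ⟨by simpa using hA1 hy, by simpa [dist_eq_norm] using (mem_ball.1 (hA2 hy)).le⟩
  have hcx : ∀ s ∈ ball (s₀ : ℂ) (ρ / 2), ∀ y ∈ A, ‖s • cx y - cx (s₀ • y₀)‖ ≤ ρ := by
    intro s hs' y hy
    obtain ⟨hy1, hy2⟩ := hA y hy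
    have : s • cx y - cx (s₀ • y₀) = (s - s₀) • cx y + (s₀ : ℂ) • cx (y - y₀) := by
      rw [cx_sub, cx_smul, sub_smul, smul_sub]; abel
    rw [this]
    refine (norm_add_le _ _).trans ?_
    rw [norm_smul, norm_smul, Complex.norm_real, Real.norm_eq_abs]
    rw [mem_ball, dist_eq_norm] at hs'
    have e1 := (norm_cx_le y).trans hy1
    have e2 := (norm_cx_le (y - y₀)).trans hy2
    have e3 := mul_le_mul hs'.le e1 (norm_nonneg _) (by positivity)
    have e4 := mul_le_mul hs.le e2 (norm_nonneg _) zero_le_one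
    linarith
  have hGA : IntegrableOn G A := Continuous.integrableOn_subset_closedBall hG hA1
  let F : ℕ → ℂ → ℂ := fun k s => ∫ y in A, eval (s • cx y - cx (s₀ • y₀)) (P k) * G y
  have hFd : DifferentiableOn ℂ (fun s => ∑' k, F k s) (ball (s₀ : ℂ) (ρ / 2)) := by
    refine Complex.differentiableOn_tsum_of_summable_norm
      (summable_half (C * ∫ y in A, ‖G y‖))
      (fun k => (differentiable_integral_eval (P k) _ hA1 hG).differentiableOn) isOpen_ball
      fun k s hs' => ?_
    refine (norm_integral_le_of_norm_le (hGA.norm.const_mul (C * (1 / 2) ^ k)) ?_).trans_eq ?_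
    · filter_upwards [ae_restrict_mem hAm] with y hy
      rw [norm_mul]
      exact mul_le_mul_of_nonneg_right (h1 k _ (hcx s hs' y hy)) (norm_nonneg _)
    · rw [integral_const_mul]; ring
  have hFa : AnalyticAt ℂ (fun s => ∑' k, F k s) s₀ :=
    hFd.analyticAt (ball_mem_nhds _ (by positivity))
  refine hFa.comp_ofReal.congr ?_
  filter_upwards [ball_mem_nhds s₀ (show 0 < ρ / 2 by positivity)] with s hs'
  have hs'' : (s : ℂ) ∈ ball (s₀ : ℂ) (ρ / 2) := by
    rw [mem_ball, dist_eq_norm] at hs' ⊢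
    rwa [← Complex.ofReal_sub, Complex.norm_real]
  refine HasSum.tsum_eq ?_
  refine hasSum_integral_of_dominated_convergence (fun k y => C * (1 / 2) ^ k * ‖G y‖)
    (fun k => (by fun_prop : Continuous fun y => eval ((s : ℂ) • cx y - cx (s₀ • y₀)) (P k) * G y
      ).aestronglyMeasurable) (fun k => ?_) ?_ ?_ ?_
  · filter_upwards [ae_restrict_mem hAm] with y hy
    rw [norm_mul]
    exact mul_le_mul_of_nonneg_right (h1 k _ (hcx s hs'' y hy)) (norm_nonneg _)
  · exact Eventually.of_forall fun y => (summable_half C).mul_right _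
  · simp only [tsum_mul_right]
    exact hGA.norm.const_mul _
  · filter_upwards [ae_restrict_mem hAm] with y hy
    refine HasSum.mul_right _ ?_
    have h3 : ‖s • y - s₀ • y₀‖ ≤ ρ := by
      obtain ⟨hy1, hy2⟩ := hA y hy
      have : s • y - s₀ • y₀ = (s - s₀) • y + s₀ • (y - y₀) := by
        rw [sub_smul, smul_sub]; abel
      rw [this]
      refine (norm_add_le _ _).trans ?_
      rw [norm_smul, norm_smul, Real.norm_eq_abs s₀]
      rw [mem_ball, dist_eq_norm] at hs'
      have e3 := mul_le_mul hs'.le hy1 (norm_nonneg _) (by positivity)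
      have e4 := mul_le_mul hs.le hy2 (norm_nonneg _) zero_le_one
      linarith
    simpa [cx_sub, cx_smul] using h2 _ h3

theorem analyticAt_integral_dilation {u G : EuclideanSpace ℝ (Fin n) → ℂ}
    (hu : AnalyticOnNhd ℝ u (ball 0 1)) (hG : Continuous G) {s₀ : ℝ} (hs : |s₀| < 1) :
    AnalyticAt ℝ (fun s : ℝ => ∫ y in ball 0 1, u (s • y) * G y) s₀ := by
  -- Compactness of the closed ball; `|s₀| < 1` keeps `s₀ y₀` in the open ball even when `|y₀| = 1`.
  -- Quantifying over all measurable `A` inside `O` makes the property stable under unions, by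
  -- splitting `A` into `A ∩ O` and `A \ O`.
  have key : ∃ O : Set (EuclideanSpace ℝ (Fin n)), MeasurableSet O ∧ closedBall 0 1 ⊆ O ∧
      ∀ A, MeasurableSet A → A ⊆ closedBall 0 1 → A ⊆ O →
        AnalyticAt ℝ (fun s : ℝ => ∫ y in A, u (s • y) * G y) s₀ := by
    refine (isCompact_closedBall (0 : EuclideanSpace ℝ (Fin n)) 1).induction_on
      (p := fun S => ∃ O : Set (EuclideanSpace ℝ (Fin n)), MeasurableSet O ∧ S ⊆ O ∧
        ∀ A, MeasurableSet A → A ⊆ closedBall 0 1 → A ⊆ O →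
        AnalyticAt ℝ (fun s : ℝ => ∫ y in A, u (s • y) * G y) s₀) ?_ ?_ ?_ ?_
    · refine ⟨∅, MeasurableSet.empty, subset_rfl, fun A _ _ hA => ?_⟩
      rw [subset_empty_iff.1 hA]
      simpa using analyticAt_const
    · rintro S T hST ⟨O, hO, hTO, h⟩
      exact ⟨O, hO, hST.trans hTO, h⟩
    · rintro S T ⟨O, hO, hSO, h⟩ ⟨O', hO', hTO', h'⟩
      refine ⟨O ∪ O', hO.union hO', union_subset_union hSO hTO', fun A hA hA1 hA2 => ?_⟩
      refine ((h (A ∩ O) (hA.inter hO) (inter_subset_left.trans hA1) inter_subset_right).add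
        (h' (A \ O) (hA.diff hO) (sdiff_subset.trans hA1)
          fun y hy => (hA2 hy.1).resolve_left hy.2)).congr ?_
      have : ∀ᶠ s : ℝ in 𝓝 s₀, |s| < 1 :=
        (continuous_abs.tendsto s₀).eventually (gt_mem_nhds hs)
      filter_upwards [this] with s hs'
      exact integral_inter_add_sdiff hO (integrableOn_dilation hu.continuousOn hG hs' hA1)
    · intro y₀ hy₀
      obtain ⟨δ, hδ, h⟩ := analyticAt_integral_dilation_local (u := u) hG hs (y₀ := y₀) (hu _ (by
        rw [mem_closedBall_zero_iff] at hy₀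
        rw [mem_ball_zero_iff, norm_smul, Real.norm_eq_abs]
        nlinarith [abs_nonneg s₀, norm_nonneg y₀]))
      exact ⟨ball y₀ δ, mem_nhdsWithin_of_mem_nhds (ball_mem_nhds _ hδ), _, measurableSet_ball,
        subset_rfl, h⟩
  obtain ⟨O, -, hO, h⟩ := key
  exact h _ measurableSet_ball ball_subset_closedBall (ball_subset_closedBall.trans hO)

/-- If the homogeneous component `P k` of `u` satisfies `∫ P k * G = 0` for all `k` outside a
finite set, then `s ↦ ∫ u (s y) G y` is a polynomial. -/
theorem integral_dilation_eq_sum {u G : EuclideanSpace ℝ (Fin n) → ℂ}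
    (hu : AnalyticOnNhd ℝ u (ball 0 1)) (hG : Continuous G) {P : ℕ → MvPolynomial (Fin n) ℂ}
    (hP : ∀ k, (P k).IsHomogeneous k) (hPu : IsLocalSum u P) (S : Finset ℕ)
    (hS : ∀ k ∉ S, ∫ y in ball 0 1, eval (cx y) (P k) * G y = 0) {s : ℝ} (hs : |s| < 1) :
    ∫ y in ball 0 1, u (s • y) * G y =
      ∑ k ∈ S, (s : ℂ) ^ k * ∫ y in ball 0 1, eval (cx y) (P k) * G y := by
  have h1 : AnalyticOnNhd ℝ (fun s : ℝ => ∫ y in ball 0 1, u (s • y) * G y) (ball 0 1) :=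
    fun s hs => analyticAt_integral_dilation hu hG (by simpa using hs)
  have h2 : AnalyticOnNhd ℝ (fun s : ℝ => ∑ k ∈ S, (s : ℂ) ^ k *
      ∫ y in ball 0 1, eval (cx y) (P k) * G y) (ball 0 1) := fun s _ =>
    Finset.analyticAt_fun_sum _ fun k _ =>
      ((Complex.ofRealCLM.analyticAt s).pow k).mul analyticAt_const
  -- Both sides are analytic on `(-1, 1)`, so it suffices to integrate the series termwise for small
  -- `s`.
  refine h1.eqOn_of_preconnected_of_eventuallyEq h2 (convex_ball _ _).isPreconnected
    (mem_ball_self one_pos) ?_ (by simpa using hs)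
  obtain ⟨ρ, C, hρ, hb, hsum⟩ := hPu
  filter_upwards [ball_mem_nhds (0 : ℝ) hρ] with s hs
  rw [mem_ball_zero_iff] at hs
  have hy : ∀ y ∈ ball (0 : EuclideanSpace ℝ (Fin n)) 1, ‖s • y‖ ≤ ρ := fun y hy => by
    rw [mem_ball_zero_iff] at hy
    rw [norm_smul]
    nlinarith [norm_nonneg s, norm_nonneg y]
  have hGA : IntegrableOn G (ball 0 1) :=
    Continuous.integrableOn_subset_closedBall hG ball_subset_closedBall
  have h3 : HasSum (fun k => ∫ y in ball 0 1, eval (cx (s • y)) (P k) * G y)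
      (∫ y in ball 0 1, u (s • y) * G y) := by
    refine hasSum_integral_of_dominated_convergence (fun k y => C * (1 / 2) ^ k * ‖G y‖)
      (fun k => (by fun_prop : Continuous fun y => eval (cx (s • y)) (P k) * G y
        ).aestronglyMeasurable) (fun k => ?_) ?_ ?_ ?_
    · filter_upwards [ae_restrict_mem measurableSet_ball] with y hy'
      rw [norm_mul]
      exact mul_le_mul_of_nonneg_right (hb k _ ((norm_cx_le _).trans (hy y hy'))) (norm_nonneg _)
    · exact Eventually.of_forall fun y => (summable_half C).mul_right _
    · simp only [tsum_mul_right]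
      exact hGA.norm.const_mul _
    · filter_upwards [ae_restrict_mem measurableSet_ball] with y hy'
      exact (hsum _ (hy y hy')).mul_right _
  have h4 : ∀ k, ∫ y in ball 0 1, eval (cx (s • y)) (P k) * G y =
      (s : ℂ) ^ k * ∫ y in ball 0 1, eval (cx y) (P k) * G y := fun k => by
    simp only [cx_smul, eval_smul_of_isHomogeneous (hP k), mul_assoc]
    exact integral_const_mul _ _
  simp only [h4] at h3
  exact h3.unique (hasSum_sum_of_ne_finset_zero fun k hk => by rw [hS k hk, mul_zero])

end Dilations

section Growth

variable {n : ℕ}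

/-! ### Growth of homogeneous polynomials near the real unit ball -/

/-- A Bernstein type inequality for homogeneous polynomials. -/
theorem norm_eval_add_imag_le {q : MvPolynomial (Fin n) ℂ} {k : ℕ} (hq : q.IsHomogeneous k) {A : ℝ}
    (hA : ∀ x : EuclideanSpace ℝ (Fin n), ‖eval (cx x) q‖ ≤ A * ‖x‖ ^ k) (hA0 : 0 ≤ A) {ρ : ℝ}
    (hρ : 1 < ρ) (x y : EuclideanSpace ℝ (Fin n)) :
    ‖eval (cx x + (Complex.I * ((ρ - ρ⁻¹) / 2 : ℝ)) • cx y) q‖ ≤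
      ρ ^ k * (A * (‖x‖ + ‖y‖) ^ k) := by
  have hρ0 : (ρ : ℂ) ≠ 0 := by exact_mod_cast (by linarith : ρ ≠ 0)
  -- On the unit circle `(s² + 1) / 2 = s Re s`, so the argument is `s` times the real point `x +
  -- (Re s) y`, where the hypothesis applies. At `s = -i / ρ` it is `s` times the complex point
  -- wanted, and the maximum principle compares the two.
  let g : ℂ → ℂ := fun s => eval (s • cx x + ((s ^ 2 + 1) / 2) • cx y) q
  have hg : Differentiable ℂ g := differentiable_eval_comp q fun i => by
    simp only [Pi.add_apply, Pi.smul_apply, smul_eq_mul]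
    fun_prop
  have hb : ∀ s ∈ frontier (ball (0 : ℂ) 1), ‖g s‖ ≤ A * (‖x‖ + ‖y‖) ^ k := by
    intro s hs
    rw [frontier_ball _ one_ne_zero, mem_sphere_zero_iff_norm] at hs
    have h1 : (s ^ 2 + 1) / 2 = s * (s.re : ℂ) := by
      have : s * conj s = 1 := by rw [Complex.mul_conj, Complex.normSq_eq_norm_sq, hs]; simp
      rw [Complex.re_eq_add_conj]
      linear_combination (-1 / 2) * this
    have h2 : s • cx x + ((s ^ 2 + 1) / 2) • cx y = s • cx (x + s.re • y) := by
      rw [cx_add, cx_smul, smul_add, smul_smul, h1]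
    simp only [g]
    rw [h2, eval_smul_of_isHomogeneous hq, norm_mul, norm_pow, hs, one_pow, one_mul]
    refine (hA _).trans (mul_le_mul_of_nonneg_left (pow_le_pow_left₀ (norm_nonneg _) ?_ _) hA0)
    refine (norm_add_le _ _).trans (add_le_add le_rfl ?_)
    rw [norm_smul, Real.norm_eq_abs]
    exact mul_le_of_le_one_left (norm_nonneg _) ((Complex.abs_re_le_norm s).trans hs.le)
  have hs0 : (-Complex.I / ρ : ℂ) ∈ closure (ball (0 : ℂ) 1) := by
    refine subset_closure ?_
    rw [mem_ball_zero_iff, norm_div, norm_neg, Complex.norm_I, Complex.norm_real, Real.norm_eq_abs,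
      abs_of_pos (by linarith), div_lt_one (by linarith)]
    exact hρ
  have h := Complex.norm_le_of_forall_mem_frontier_norm_le isBounded_ball hg.diffContOnCl hb hs0
  have h3 : g (-Complex.I / ρ) = (-Complex.I / ρ) ^ k *
      eval (cx x + (Complex.I * ((ρ - ρ⁻¹) / 2 : ℝ)) • cx y) q := by
    rw [← eval_smul_of_isHomogeneous hq, smul_add, smul_smul]
    simp only [g]
    congr 4
    push_cast
    field_simp
    simp only [Complex.I_sq]
    ring
  rw [h3, norm_mul, norm_pow, norm_div, norm_neg, Complex.norm_I, Complex.norm_real,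
    Real.norm_eq_abs, abs_of_pos (by linarith), one_div, inv_pow] at h
  have hρk : 0 < ρ ^ k := by positivity
  rwa [inv_mul_le_iff₀ hρk] at h

theorem norm_le_of_forall_abs_le {v : EuclideanSpace ℝ (Fin n)} {d : ℝ} (h : ∀ i, |v i| ≤ d) :
    ‖v‖ ≤ n * d := by
  have hv := (EuclideanSpace.basisFun (Fin n) ℝ).sum_repr v
  have h1 : ∀ i ∈ Finset.univ, ‖(EuclideanSpace.basisFun (Fin n) ℝ).repr v i •
      EuclideanSpace.basisFun (Fin n) ℝ i‖ ≤ d := fun i _ => by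
    rw [norm_smul]
    simpa using h i
  have h2 := norm_sum_le_of_le _ h1
  rw [hv] at h2
  simpa using h2

/-- Write `z = X + iY` with `X`, `Y` real and apply the Bernstein inequality with `ρ = √l` to `X`
and `Y / η`. One factor `ρ ^ k` comes from the inequality, the other from `‖X‖ + ‖Y‖ / η ≤ 1 + n δ
(1 + 1 / η) ≤ ρ`, which dictates `δ`. -/
theorem exists_norm_eval_le {l : ℝ} (hl : 1 < l) {δ₀ : ℝ} (hδ₀ : 0 < δ₀) :
    ∃ δ, 0 < δ ∧ δ ≤ δ₀ ∧ ∀ (k : ℕ) (q : MvPolynomial (Fin n) ℂ) (A : ℝ), q.IsHomogeneous k →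
      (∀ x : EuclideanSpace ℝ (Fin n), ‖eval (cx x) q‖ ≤ A * ‖x‖ ^ k) → 0 ≤ A →
      ∀ (x : EuclideanSpace ℝ (Fin n)) (z : Fin n → ℂ), ‖x‖ ≤ 1 → ‖z - cx x‖ ≤ δ →
        ‖eval z q‖ ≤ A * l ^ k := by
  set ρ : ℝ := √l with hρdef
  have hρ : 1 < ρ := Real.lt_sqrt_of_sq_lt (by simpa using hl)
  have hρl : ρ * ρ = l := Real.mul_self_sqrt (by linarith)
  set η : ℝ := (ρ - ρ⁻¹) / 2 with hη
  have hη0 : 0 < η := by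
    have : ρ⁻¹ < 1 := inv_lt_one_of_one_lt₀ hρ
    rw [hη]; linarith
  refine ⟨min δ₀ ((ρ - 1) / ((n + 1) * (1 + η⁻¹))), lt_min hδ₀ (div_pos (by linarith)
    (by positivity)), min_le_left _ _, ?_⟩
  intro k q A hq hA hA0 x z hx hz
  set δ : ℝ := (ρ - 1) / ((n + 1) * (1 + η⁻¹)) with hδ
  replace hz : ‖z - cx x‖ ≤ δ := hz.trans (min_le_right _ _)
  have hδ0 : 0 < δ := div_pos (by linarith) (by positivity)
  let X : EuclideanSpace ℝ (Fin n) := WithLp.toLp 2 fun i => (z i).re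
  let Y : EuclideanSpace ℝ (Fin n) := WithLp.toLp 2 fun i => (z i).im
  have hi : ∀ i, ‖z i - (x i : ℂ)‖ ≤ δ := fun i => (norm_le_pi_norm (z - cx x) i).trans hz
  have hX : ‖X - x‖ ≤ n * δ := norm_le_of_forall_abs_le fun i => by
    have := (Complex.abs_re_le_norm (z i - (x i : ℂ))).trans (hi i)
    simpa [X] using this
  have hY : ‖Y‖ ≤ n * δ := norm_le_of_forall_abs_le fun i => by
    have := (Complex.abs_im_le_norm (z i - (x i : ℂ))).trans (hi i)
    simpa [Y] using this
  have hXn : ‖X‖ ≤ 1 + n * δ := by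
    calc ‖X‖ = ‖x + (X - x)‖ := by congr 1; abel
      _ ≤ _ := (norm_add_le _ _).trans (add_le_add hx hX)
  have hz' : z = cx X + (Complex.I * (η : ℂ)) • cx (η⁻¹ • Y) := by
    ext i
    have : (η : ℂ) ≠ 0 := by exact_mod_cast hη0.ne'
    simp only [Pi.add_apply, cx_apply, Pi.smul_apply, PiLp.smul_apply, smul_eq_mul, X, Y]
    push_cast
    rw [mul_assoc, mul_inv_cancel_left₀ this, mul_comm]
    exact (Complex.re_add_im (z i)).symm
  rw [hz']
  refine (norm_eval_add_imag_le hq hA hA0 hρ X (η⁻¹ • Y)).trans ?_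
  have h1 : ‖X‖ + ‖η⁻¹ • Y‖ ≤ ρ := by
    rw [norm_smul, Real.norm_eq_abs, abs_of_pos (inv_pos.2 hη0)]
    have h2 : η⁻¹ * ‖Y‖ ≤ η⁻¹ * (n * δ) := mul_le_mul_of_nonneg_left hY (by positivity)
    have h3 : ((n : ℝ) + 1) * (1 + η⁻¹) * δ = ρ - 1 := by
      rw [hδ]; field_simp
    have h4 : 0 ≤ (1 + η⁻¹) * δ := by positivity
    linarith
  calc ρ ^ k * (A * (‖X‖ + ‖η⁻¹ • Y‖) ^ k) ≤ ρ ^ k * (A * ρ ^ k) := by gcongr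
    _ = A * l ^ k := by rw [← hρl, mul_pow]; ring

/-- The square of the weighted `L²` norm of a polynomial over the unit ball. -/
def wnormSq (q : MvPolynomial (Fin n) ℂ) : ℝ :=
  ∫ x : EuclideanSpace ℝ (Fin n), weight 1 x * ‖eval (cx x) q‖ ^ 2

theorem integrable_wnormSq (q : MvPolynomial (Fin n) ℂ) :
    Integrable fun x : EuclideanSpace ℝ (Fin n) => weight 1 x * ‖eval (cx x) q‖ ^ 2 := by
  have := (integrable_weight (m := 1) one_ne_zero
    (F := fun x : EuclideanSpace ℝ (Fin n) => ((‖eval (cx x) q‖ ^ 2 : ℝ) : ℂ)) (by fun_prop)).re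
  refine this.congr (Eventually.of_forall fun x => ?_)
  simp only [← Complex.ofReal_mul]
  exact RCLike.ofReal_re (K := ℂ) _

theorem wnormSq_nonneg (q : MvPolynomial (Fin n) ℂ) : 0 ≤ wnormSq q :=
  integral_nonneg fun x => mul_nonneg (weight_nonneg _ _) (by positivity)

theorem exists_forall_norm_eval_le {q : MvPolynomial (Fin n) ℂ} {k : ℕ} (hq : q.IsHomogeneous k) :
    ∃ x₀ : EuclideanSpace ℝ (Fin n), ‖x₀‖ ≤ 1 ∧
      ∀ x : EuclideanSpace ℝ (Fin n), ‖eval (cx x) q‖ ≤ ‖eval (cx x₀) q‖ * ‖x‖ ^ k := by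
  obtain ⟨x₀, hx₀, h⟩ := (isCompact_closedBall (0 : EuclideanSpace ℝ (Fin n)) 1).exists_isMaxOn
    ⟨0, by simp⟩ (f := fun x => ‖eval (cx x) q‖) (by fun_prop)
  refine ⟨x₀, by simpa using hx₀, fun x => ?_⟩
  obtain ⟨v, hv, hxv⟩ : ∃ v : EuclideanSpace ℝ (Fin n), ‖v‖ ≤ 1 ∧ x = ‖x‖ • v := by
    rcases eq_or_ne x 0 with rfl | hx
    · exact ⟨0, by simp, by simp⟩
    · exact ⟨‖x‖⁻¹ • x, by simp [norm_smul, hx], by simp [smul_smul, hx]⟩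
  have h1 : ‖eval (cx x) q‖ = ‖x‖ ^ k * ‖eval (cx v) q‖ := by
    conv_lhs => rw [hxv]
    rw [cx_smul, eval_smul_of_isHomogeneous hq, norm_mul, norm_pow, Complex.norm_real, norm_norm]
  rw [h1, mul_comm]
  exact mul_le_mul_of_nonneg_right (h (by simpa using hv)) (by positivity)

/-- Schwarz's lemma on the complex line through `x₀` in direction `v`: a disc of radius `6 l ^ k` is
mapped into one of radius `3 A l ^ k` about the value at `x₀`, so a unit step changes the value by
at most `A / 2`. -/
theorem half_le_norm_eval {q : MvPolynomial (Fin n) ℂ} {k : ℕ} {A l δ : ℝ} (hA : 0 < A)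
    (hl : 1 < l) {x₀ v : EuclideanSpace ℝ (Fin n)} (hx₀ : ‖eval (cx x₀) q‖ = A)
    (h : ∀ z : Fin n → ℂ, ‖z - cx x₀‖ ≤ δ → ‖eval z q‖ ≤ A * l ^ k)
    (hv : ‖v‖ ≤ δ / (6 * l ^ k)) : A / 2 ≤ ‖eval (cx (x₀ + v)) q‖ := by
  have hlk : 1 ≤ l ^ k := one_le_pow₀ hl.le
  let f : ℂ → ℂ := fun w => eval (cx x₀ + w • cx v) q
  have hf : Differentiable ℂ f := fun w => (hasDerivAt_eval q (cx x₀) (cx v) w).differentiableAt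
  have hf0 : f 0 = eval (cx x₀) q := by simp [f]
  have hmaps : MapsTo f (ball 0 (6 * l ^ k)) (ball (f 0) (3 * (A * l ^ k))) := by
    intro w hw
    rw [mem_ball_zero_iff] at hw
    have h1 : ‖f w‖ ≤ A * l ^ k := by
      refine h _ ?_
      rw [add_sub_cancel_left, norm_smul]
      calc ‖w‖ * ‖cx v‖ ≤ (6 * l ^ k) * (δ / (6 * l ^ k)) :=
            mul_le_mul hw.le ((norm_cx_le v).trans hv) (norm_nonneg _) (by positivity)
        _ = δ := by field_simp
    have h2 : ‖f 0‖ ≤ A * l ^ k := by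
      rw [hf0, hx₀]; nlinarith
    rw [mem_ball, dist_eq_norm]
    have h3 : 0 < A * l ^ k := by positivity
    linarith [norm_sub_le (f w) (f 0)]
  have hd := Complex.dist_le_div_mul_dist_of_mapsTo_ball (z := 1) hf.differentiableOn
    (hmaps.mono_right ball_subset_closedBall) (by
      rw [mem_ball_zero_iff, norm_one]; linarith)
  have h1 : f 1 = eval (cx (x₀ + v)) q := by simp [f, cx_add]
  have h2 : 3 * (A * l ^ k) / (6 * l ^ k) * dist (1 : ℂ) 0 = A / 2 := by
    rw [dist_zero_right, norm_one]; field_simp; norm_num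
  rw [h2, h1, hf0, dist_eq_norm] at hd
  have h3 := norm_sub_norm_le (eval (cx x₀) q) (eval (cx (x₀ + v)) q)
  rw [norm_sub_rev] at h3
  linarith

/-- Near the real unit ball, a homogeneous polynomial of degree `k` is bounded by its `L²` norm over
the unit ball, up to a factor which grows exponentially in `k` with an arbitrarily small rate. -/
theorem exists_norm_eval_sq_le (n : ℕ) {l : ℝ} (hl : 1 < l) :
    ∃ δ C : ℝ, 0 < δ ∧ 0 < C ∧ ∀ (k : ℕ) (q : MvPolynomial (Fin n) ℂ), q.IsHomogeneous k →
      ∀ (x : EuclideanSpace ℝ (Fin n)) (z : Fin n → ℂ), ‖x‖ ≤ 1 → ‖z - cx x‖ ≤ δ →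
        ‖eval z q‖ ^ 2 ≤ C * l ^ k * wnormSq q := by
  -- The exponent counts the losses in powers of `l₀ ^ k`: `n` from the volume of a ball of radius
  -- proportional to `1 / l₀ ^ k`, 2 from the dilation by `r`, and 2 from the squared bound near the
  -- real ball.
  obtain ⟨l₀, hl₀, hl₀l⟩ : ∃ l₀ : ℝ, 1 < l₀ ∧ l₀ ^ (n + 4) = l :=
    ⟨l ^ (((n + 4 : ℕ) : ℝ)⁻¹), Real.one_lt_rpow hl (by positivity),
      Real.rpow_inv_natCast_pow (by linarith) (by omega)⟩
  -- The maximum point may lie on the unit sphere, where the weight vanishes. Shrinking by `r` moves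
  -- a small ball around it into `‖y‖ ≤ (1 + r) / 2`, where the weight is at least `c`; the choice
  -- `δ₀ = (1 - r) / 2` ensures this.
  set r : ℝ := l₀⁻¹ with hr
  have hr0 : 0 < r := by positivity
  have hr1 : r < 1 := inv_lt_one_of_one_lt₀ hl₀
  obtain ⟨δ, hδ, hδ1, h⟩ := exists_norm_eval_le (n := n) hl₀ (δ₀ := (1 - r) / 2) (by linarith)
  set c : ℝ := 1 - ((1 + r) / 2) ^ 2 with hc
  have hc0 : 0 < c := by rw [hc]; nlinarith
  set ω : ℝ := (volume (ball (0 : EuclideanSpace ℝ (Fin n)) 1)).toReal with hω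
  have hω0 : 0 < ω := ENNReal.toReal_pos (measure_ball_pos _ _ one_pos).ne' measure_ball_lt_top.ne
  set K : ℝ := c / 4 * (r * (δ / 6)) ^ n * ω with hK
  have hK0 : 0 < K := by positivity
  refine ⟨δ, K⁻¹, hδ, by positivity, fun k q hq x z hx hz => ?_⟩
  obtain ⟨x₀, hx₀, hmax⟩ := exists_forall_norm_eval_le hq
  set A : ℝ := ‖eval (cx x₀) q‖ with hA
  have h1 := h k q A hq hmax (norm_nonneg _) x z hx hz
  have hlk : 1 ≤ l₀ ^ k := one_le_pow₀ hl₀.le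
  have h2 : K * A ^ 2 ≤ (l₀ ^ k) ^ (n + 2) * wnormSq q := by
    rcases (norm_nonneg (eval (cx x₀) q)).eq_or_lt with hA0 | hA0
    · rw [hA, ← hA0]
      have := wnormSq_nonneg q
      simp only [ne_eq, OfNat.ofNat_ne_zero, not_false_eq_true, zero_pow, mul_zero]
      positivity
    set τ : ℝ := δ / (6 * l₀ ^ k) with hτ
    have hτ0 : 0 < τ := by positivity
    have hτδ : τ ≤ δ := by
      rw [hτ]; exact div_le_self hδ.le (by linarith)
    let D : Set (EuclideanSpace ℝ (Fin n)) := closedBall (r • x₀) (r * τ)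
    have hD : ∀ y ∈ D, c * (r ^ k * (A / 2)) ^ 2 ≤ weight 1 y * ‖eval (cx y) q‖ ^ 2 := by
      intro y hy
      rw [mem_closedBall, dist_eq_norm] at hy
      set v : EuclideanSpace ℝ (Fin n) := r⁻¹ • y - x₀ with hv
      have hyv : y = r • (x₀ + v) := by
        rw [hv, add_sub_cancel, smul_inv_smul₀ hr0.ne']
      have hvτ : ‖v‖ ≤ τ := by
        have : y - r • x₀ = r • v := by rw [hyv, smul_add, add_sub_cancel_left]
        rw [this, norm_smul, Real.norm_eq_abs, abs_of_pos hr0] at hy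
        exact le_of_mul_le_mul_left hy hr0
      have hq1 := half_le_norm_eval hA0 hl₀ hA.symm
        (fun z hz => h k q A hq hmax (norm_nonneg _) x₀ z hx₀ hz) hvτ
      have hq2 : ‖eval (cx y) q‖ = r ^ k * ‖eval (cx (x₀ + v)) q‖ := by
        conv_lhs => rw [hyv]
        rw [cx_smul, eval_smul_of_isHomogeneous hq, norm_mul, norm_pow, Complex.norm_real,
          Real.norm_eq_abs, abs_of_pos hr0]
      have hyn : ‖y‖ ≤ (1 + r) / 2 := by
        rw [hyv, norm_smul, Real.norm_eq_abs, abs_of_pos hr0]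
        have : ‖x₀ + v‖ ≤ 1 + (1 - r) / 2 := (norm_add_le _ _).trans (by linarith)
        nlinarith
      have hw : c ≤ weight 1 y := by
        rw [weight, pow_one, hc]
        refine le_max_of_le_right ?_
        have := pow_le_pow_left₀ (norm_nonneg y) hyn 2
        linarith
      rw [hq2]
      refine mul_le_mul hw (pow_le_pow_left₀ (by positivity) ?_ 2) (by positivity)
        (weight_nonneg _ _)
      exact mul_le_mul_of_nonneg_left hq1 (by positivity)
    have hI : c * (r ^ k * (A / 2)) ^ 2 * (volume D).toReal ≤ wnormSq q := by
      calc c * (r ^ k * (A / 2)) ^ 2 * (volume D).toReal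
          = ∫ _ in D, c * (r ^ k * (A / 2)) ^ 2 := by
            rw [setIntegral_const, smul_eq_mul, mul_comm]; rfl
        _ ≤ ∫ y in D, weight 1 y * ‖eval (cx y) q‖ ^ 2 :=
            setIntegral_mono_on (integrableOn_const measure_closedBall_lt_top.ne)
              (integrable_wnormSq q).integrableOn measurableSet_closedBall hD
        _ ≤ wnormSq q := setIntegral_le_integral (integrable_wnormSq q)
            (Eventually.of_forall fun y => mul_nonneg (weight_nonneg _ _) (by positivity))
    have hvol : (volume D).toReal = (r * τ) ^ n * ω := by
      simp only [D]
      rw [Measure.addHaar_closedBall _ _ (by positivity), ENNReal.toReal_mul,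
        ENNReal.toReal_ofReal (by positivity), finrank_euclideanSpace_fin]
    rw [hvol] at hI
    refine le_trans (le_of_eq ?_) (mul_le_mul_of_nonneg_left hI
      (by positivity : 0 ≤ (l₀ ^ k) ^ (n + 2)))
    have hrl : r * l₀ = 1 := inv_mul_cancel₀ (by linarith)
    have e1 : (r ^ k) ^ 2 * (l₀ ^ k) ^ 2 = 1 := by
      rw [← mul_pow, ← mul_pow, hrl, one_pow, one_pow]
    have e2 : (r * τ) ^ n * (l₀ ^ k) ^ n = (r * (δ / 6)) ^ n := by
      rw [← mul_pow, hτ]; congr 1; field_simp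
    calc K * A ^ 2 = c / 4 * A ^ 2 * ω * ((r * (δ / 6)) ^ n) := by rw [hK]; ring
      _ = c / 4 * A ^ 2 * ω * ((r * τ) ^ n * (l₀ ^ k) ^ n) * ((r ^ k) ^ 2 * (l₀ ^ k) ^ 2) := by
          rw [e1, e2, mul_one]
      _ = _ := by ring
  have hN := wnormSq_nonneg q
  calc ‖eval z q‖ ^ 2 ≤ (A * l₀ ^ k) ^ 2 := pow_le_pow_left₀ (norm_nonneg _) h1 2
    _ = K⁻¹ * (K * A ^ 2) * (l₀ ^ k) ^ 2 := by field_simp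
    _ ≤ K⁻¹ * ((l₀ ^ k) ^ (n + 2) * wnormSq q) * (l₀ ^ k) ^ 2 := by gcongr
    _ = K⁻¹ * l ^ k * wnormSq q := by rw [← hl₀l]; ring

end Growth

section Components

variable {n : ℕ}

/-! ### Growth of the homogeneous components of a polyharmonic function -/

theorem weight_mul_eq_indicator (F : EuclideanSpace ℝ (Fin n) → ℂ) :
    ∫ x, (weight 1 x : ℂ) * F x = ∫ x in ball 0 1, (weight 1 x : ℂ) * F x := by
  refine (setIntegral_eq_integral_of_forall_compl_eq_zero fun x hx => ?_).symm
  rw [weight_eq_zero one_ne_zero (by simpa using hx)]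
  simp

theorem setIntegral_eval_mul_conj (P Q : MvPolynomial (Fin n) ℂ) :
    ∫ y in ball (0 : EuclideanSpace ℝ (Fin n)) 1,
      eval (cx y) P * ((weight 1 y : ℂ) * conj (eval (cx y) Q)) = wint 0 (P * conjPoly Q) := by
  rw [wint_apply, weight_mul_eq_indicator]
  refine integral_congr_ae (Eventually.of_forall fun y => ?_)
  simp only [map_mul, eval_conjPoly]
  ring

theorem wint_mul_conjPoly_self (P : MvPolynomial (Fin n) ℂ) :
    wint 0 (P * conjPoly P) = (wnormSq P : ℂ) := by
  rw [wint_apply, wnormSq, ← integral_complex_ofReal]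
  refine integral_congr_ae (Eventually.of_forall fun y => ?_)
  simp only [map_mul, eval_conjPoly, Complex.mul_conj, Complex.normSq_eq_norm_sq]
  push_cast
  rfl

theorem norm_integral_mul_sq_le {α : Type*} [MeasurableSpace α] {μ : Measure α} {f g : α → ℂ}
    (hf : MemLp f 2 μ) (hg : MemLp g 2 μ) :
    ‖∫ a, f a * g a ∂μ‖ ^ 2 ≤ (∫ a, ‖f a‖ ^ 2 ∂μ) * ∫ a, ‖g a‖ ^ 2 ∂μ := by
  have h := integral_mul_norm_le_Lp_mul_Lq (μ := μ) (f := f) (g := g) (p := 2) (q := 2)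
    Real.HolderConjugate.two_two (by simpa using hf) (by simpa using hg)
  have h1 : ‖∫ a, f a * g a ∂μ‖ ≤ ∫ a, ‖f a‖ * ‖g a‖ ∂μ := by
    simpa only [norm_mul] using norm_integral_le_integral_norm (fun a => f a * g a)
  refine (pow_le_pow_left₀ (norm_nonneg _) (h1.trans h) 2).trans_eq ?_
  simp only [Real.rpow_two, ← Real.sqrt_eq_rpow]
  rw [mul_pow, Real.sq_sqrt (integral_nonneg fun _ => by positivity),
    Real.sq_sqrt (integral_nonneg fun _ => by positivity)]

theorem integral_norm_sq_dilation_le {u : EuclideanSpace ℝ (Fin n) → ℂ}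
    (hu : MemLp u 2 (volume.restrict (ball 0 1))) {s t : ℝ} (ht : 0 < t) (hts : t ≤ s) (hs : s < 1) :
    ∫ y in ball (0 : EuclideanSpace ℝ (Fin n)) 1, ‖u (s • y)‖ ^ 2 ≤
      (t ^ n)⁻¹ * ∫ y in ball (0 : EuclideanSpace ℝ (Fin n)) 1, ‖u y‖ ^ 2 := by
  have hs0 : 0 < s := ht.trans_le hts
  rw [Measure.setIntegral_comp_smul_of_pos volume (fun y => ‖u y‖ ^ 2) _ hs0, smul_eq_mul,
    finrank_euclideanSpace_fin]
  have h0 : ∀ A : Set (EuclideanSpace ℝ (Fin n)), 0 ≤ ∫ y in A, ‖u y‖ ^ 2 := fun A =>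
    integral_nonneg fun _ => by positivity
  refine mul_le_mul ?_ ?_ (h0 _) (by positivity)
  · gcongr
  · refine setIntegral_mono_set hu.norm.integrable_sq
      (Eventually.of_forall fun _ => by simp only [Pi.zero_apply]; positivity)
      (LE.le.eventuallyLE ?_)
    rintro _ ⟨y, hy, rfl⟩
    rw [mem_ball_zero_iff] at hy ⊢
    simp only [norm_smul, Real.norm_eq_abs, abs_of_pos hs0]
    nlinarith [norm_nonneg y]

theorem memLp_dilation {u : EuclideanSpace ℝ (Fin n) → ℂ} (hu : ContinuousOn u (ball 0 1)) {s : ℝ}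
    (hs : |s| < 1) : MemLp (fun y => u (s • y)) 2 (volume.restrict (ball 0 1)) := by
  have hc : ContinuousOn (fun y : EuclideanSpace ℝ (Fin n) => u (s • y)) (closedBall 0 1) := by
    refine hu.comp (by fun_prop) fun y hy => ?_
    rw [mem_closedBall_zero_iff] at hy
    rw [mem_ball_zero_iff, norm_smul, Real.norm_eq_abs]
    nlinarith [abs_nonneg s, norm_nonneg y]
  rw [memLp_two_iff_integrable_sq_norm]
  · exact ((hc.norm.pow 2).integrableOn_compact (isCompact_closedBall _ _)).mono_set
      ball_subset_closedBall
  · exact (hc.mono ball_subset_closedBall).aestronglyMeasurable measurableSet_ball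

theorem memLp_weight_conj (P : MvPolynomial (Fin n) ℂ) :
    MemLp (fun y : EuclideanSpace ℝ (Fin n) => (weight 1 y : ℂ) * conj (eval (cx y) P)) 2
      (volume.restrict (ball 0 1)) := by
  have hc : Continuous fun y : EuclideanSpace ℝ (Fin n) =>
      (weight 1 y : ℂ) * conj (eval (cx y) P) := by fun_prop
  rw [memLp_two_iff_integrable_sq_norm hc.aestronglyMeasurable]
  exact ((hc.norm.pow 2).continuousOn.integrableOn_compact (isCompact_closedBall _ _)).mono_set
    ball_subset_closedBall

/-- The weight lies between 0 and 1, so its square is at most itself. -/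
theorem integral_norm_sq_weight_conj_le (P : MvPolynomial (Fin n) ℂ) :
    ∫ y in ball (0 : EuclideanSpace ℝ (Fin n)) 1, ‖(weight 1 y : ℂ) * conj (eval (cx y) P)‖ ^ 2 ≤
      wnormSq P := by
  have h1 : ∫ y in ball (0 : EuclideanSpace ℝ (Fin n)) 1,
      ‖(weight 1 y : ℂ) * conj (eval (cx y) P)‖ ^ 2 ≤
      ∫ y in ball (0 : EuclideanSpace ℝ (Fin n)) 1, weight 1 y * ‖eval (cx y) P‖ ^ 2 := by
    refine integral_mono (memLp_weight_conj P).norm.integrable_sq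
      (integrable_wnormSq P).integrableOn fun y => ?_
    simp only [norm_mul, Complex.norm_real, Real.norm_eq_abs, RCLike.norm_conj, mul_pow, sq_abs]
    refine mul_le_mul_of_nonneg_right ?_ (by positivity)
    nlinarith [weight_nonneg 1 y, weight_le_one 1 y]
  exact h1.trans (setIntegral_le_integral (integrable_wnormSq P)
    (Eventually.of_forall fun y => mul_nonneg (weight_nonneg _ _) (by positivity)))

/-- A coefficient of a polynomial of bounded degree is bounded by its values on `(t, 1)`. -/
theorem exists_norm_coeff_le (L N : ℕ) {t : ℝ} (ht : t < 1) :
    ∃ K : ℝ, 0 < K ∧ ∀ (Q : Polynomial ℂ) (M : ℝ), Q.degree < N →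
      (∀ s : ℝ, t < s → s < 1 → ‖Q.eval (s : ℂ)‖ ≤ M) → ‖Q.coeff L‖ ≤ K * M := by
  -- Lagrange interpolation at distinct nodes of `(t, 1)`: the constant is the sum of the relevant
  -- coefficients of the basis polynomials, plus 1 to be positive.
  let v : ℕ → ℝ := fun i => 1 - (1 - t) / (i + 2)
  have hv1 : ∀ i, t < v i ∧ v i < 1 := fun i => by
    have h1 : 0 < (1 - t) / ((i : ℝ) + 2) := div_pos (by linarith) (by positivity)
    have h2 : (1 - t) / ((i : ℝ) + 2) < 1 - t := by
      refine div_lt_self (by linarith) ?_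
      have : (0 : ℝ) ≤ i := i.cast_nonneg
      linarith
    constructor <;> simp only [v] <;> linarith
  have hv2 : Function.Injective fun i => (v i : ℂ) := fun i j hij => by
    have h1 : v i = v j := Complex.ofReal_injective hij
    have h2 : (1 - t) / ((i : ℝ) + 2) = (1 - t) / ((j : ℝ) + 2) := by simp only [v] at h1; linarith
    rw [div_eq_div_iff (by positivity) (by positivity)] at h2
    have h3 := mul_left_cancel₀ (by linarith : 1 - t ≠ 0) h2
    have h4 : (j : ℝ) = i := by linarith
    exact_mod_cast h4.symm
  refine ⟨∑ i ∈ Finset.range N, ‖(Lagrange.basis (Finset.range N) (fun i => (v i : ℂ)) i).coeff L‖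
    + 1, by positivity, fun Q M hQ hM => ?_⟩
  have h := Lagrange.eq_interpolate (s := Finset.range N) (v := fun i => (v i : ℂ))
    hv2.injOn (by simpa using hQ)
  have hM0 : 0 ≤ M := (norm_nonneg _).trans (hM _ (hv1 0).1 (hv1 0).2)
  rw [h, Lagrange.interpolate_apply, Polynomial.finsetSum_coeff, add_mul, Finset.sum_mul, one_mul]
  refine le_trans (norm_sum_le_of_le _ fun i _ => ?_) (le_add_of_nonneg_right hM0)
  rw [Polynomial.coeff_C_mul, norm_mul, mul_comm]
  exact mul_le_mul_of_nonneg_left (hM _ (hv1 i).1 (hv1 i).2) (norm_nonneg _)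

/-- The weighted norms of the homogeneous components of a square-integrable polyharmonic function
grow at most exponentially, with an arbitrarily small rate. -/
theorem exists_wnormSq_le (n p : ℕ) {t : ℝ} (ht0 : 0 < t) (ht1 : t < 1) :
    ∃ K : ℝ, 0 < K ∧ ∀ (u : EuclideanSpace ℝ (Fin n) → ℂ) (P : ℕ → MvPolynomial (Fin n) ℂ),
      AnalyticOnNhd ℝ u (ball 0 1) → IsLocalSum u P → (∀ k, (P k).IsHomogeneous k) →
      (∀ k, polyLap^[p] (P k) = 0) → MemLp u 2 (volume.restrict (ball 0 1)) →
      ∀ k, wnormSq (P k) ≤ K * ((t ^ k)⁻¹) ^ 2 *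
        ∫ y in ball (0 : EuclideanSpace ℝ (Fin n)) 1, ‖u y‖ ^ 2 := by
  set L : ℕ := 4 * p with hL
  obtain ⟨K, hK, hcoeff⟩ := exists_norm_coeff_le L (2 * L + 1) ht1
  refine ⟨K ^ 2 * (t ^ n)⁻¹, by positivity, fun u P hu hPu hP hPp huL k => ?_⟩
  set I : ℝ := ∫ y in ball (0 : EuclideanSpace ℝ (Fin n)) 1, ‖u y‖ ^ 2 with hI
  have hI0 : 0 ≤ I := integral_nonneg fun _ => by positivity
  let G : EuclideanSpace ℝ (Fin n) → ℂ := fun y => (weight 1 y : ℂ) * conj (eval (cx y) (P k))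
  have hG : Continuous G := by fun_prop
  let a : ℕ → ℂ := fun j => ∫ y in ball 0 1, eval (cx y) (P j) * G y
  have ha : ∀ j, a j = wint 0 (P j * conjPoly (P k)) := fun j => setIntegral_eval_mul_conj _ _
  have hak : a k = (wnormSq (P k) : ℂ) := by rw [ha, wint_mul_conjPoly_self]
  let S : Finset ℕ := Finset.Icc (k - L) (k + L)
  have hS : ∀ j ∉ S, a j = 0 := by
    intro j hj
    rw [ha]
    refine wint_mul_eq_zero (N := 2 * p) (a := p) (b := p) (by omega) 0 (hP j)
      ((hP k).map (starRingEnd ℂ)) (hPp j) ?_ ?_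
    · have := polyLap_iterate_conjPoly p (P k)
      rw [hPp k] at this
      simpa [conjPoly] using this
    · simp only [S, Finset.mem_Icc, not_and_or, not_le] at hj
      rw [le_abs]
      omega
  -- `Q` is the dilated integral multiplied by `s ^ (L - k)`. Its degree is at most `2 L`,
  -- independently of `k`, so the constant `K` is uniform. For `j ∈ S` the subtraction in `j + L -
  -- k` is exact.
  let Q : Polynomial ℂ := ∑ j ∈ S, Polynomial.monomial (j + L - k) (a j)
  have hQdeg : Q.degree < (2 * L + 1 : ℕ) := by
    refine (Polynomial.degree_sum_le _ _).trans_lt ?_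
    rw [Finset.sup_lt_iff (WithBot.bot_lt_coe _)]
    intro j hj
    refine (Polynomial.degree_monomial_le _ _).trans_lt ?_
    simp only [S, Finset.mem_Icc] at hj
    exact_mod_cast (by omega : j + L - k < 2 * L + 1)
  have hQc : Q.coeff L = a k := by
    simp only [Q, Polynomial.finsetSum_coeff, Polynomial.coeff_monomial]
    rw [Finset.sum_eq_single k]
    · simp
    · intro j hj hjk
      simp only [S, Finset.mem_Icc] at hj
      rw [if_neg (by omega)]
    · intro hk
      exact absurd (Finset.mem_Icc.2 ⟨by omega, by omega⟩) hk
  have hbound : ∀ s : ℝ, t < s → s < 1 →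
      ‖Q.eval (s : ℂ)‖ ≤ (t ^ k)⁻¹ * √((t ^ n)⁻¹ * I * wnormSq (P k)) := by
    intro s hts hs1
    have hs0 : 0 < s := ht0.trans hts
    have hs : |s| < 1 := by rwa [abs_of_pos hs0]
    have h1 : Q.eval (s : ℂ) * (s : ℂ) ^ k =
        (s : ℂ) ^ L * ∫ y in ball 0 1, u (s • y) * G y := by
      rw [integral_dilation_eq_sum hu hG hP hPu S hS hs]
      simp only [Q, Polynomial.eval_finsetSum, Polynomial.eval_monomial, Finset.sum_mul,
        Finset.mul_sum]
      refine Finset.sum_congr rfl fun j hj => ?_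
      simp only [S, Finset.mem_Icc] at hj
      rw [mul_assoc, ← pow_add, ← mul_assoc, ← pow_add, mul_comm,
        show j + L - k + k = L + j by omega]
    have h2 : ‖∫ y in ball 0 1, u (s • y) * G y‖ ≤ √((t ^ n)⁻¹ * I * wnormSq (P k)) := by
      refine Real.le_sqrt_of_sq_le ?_
      refine (norm_integral_mul_sq_le (memLp_dilation hu.continuousOn hs)
        (memLp_weight_conj (P k))).trans ?_
      exact mul_le_mul (integral_norm_sq_dilation_le huL ht0 hts.le hs1)
        (integral_norm_sq_weight_conj_le (P k)) (integral_nonneg fun _ => by positivity)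
        (by positivity)
    have h3 : ‖Q.eval (s : ℂ)‖ * s ^ k ≤ √((t ^ n)⁻¹ * I * wnormSq (P k)) := by
      have := congrArg norm h1
      rw [norm_mul, norm_mul, norm_pow, norm_pow, Complex.norm_real, Real.norm_eq_abs,
        abs_of_pos hs0] at this
      rw [this]
      exact (mul_le_of_le_one_left (norm_nonneg _) (pow_le_one₀ hs0.le hs1.le)).trans h2
    rw [← div_eq_inv_mul, le_div_iff₀ (by positivity)]
    exact (mul_le_mul_of_nonneg_left (pow_le_pow_left₀ ht0.le hts.le k) (norm_nonneg _)).trans h3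
  have h := hcoeff Q _ hQdeg hbound
  have hN := wnormSq_nonneg (P k)
  rw [hQc, hak, Complex.norm_real, Real.norm_eq_abs, abs_of_nonneg hN] at h
  -- The squared norm occurs on the right under a square root; after squaring, one factor of it
  -- cancels.
  rcases hN.eq_or_lt with hN0 | hN0
  · rw [← hN0]; positivity
  have h4 := pow_le_pow_left₀ hN h 2
  rw [mul_pow, mul_pow, Real.sq_sqrt (by positivity)] at h4
  refine le_of_mul_le_mul_right ?_ hN0
  calc wnormSq (P k) * wnormSq (P k) = wnormSq (P k) ^ 2 := (sq _).symm
    _ ≤ _ := h4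
    _ = _ := by ring

/-- The homogeneous components of a square-integrable polyharmonic function decay geometrically
near each point of the rotated balls. -/
theorem exists_norm_eval_component_sq_le (p : ℕ) {c : ℂ} (hc : ‖c‖ = 1)
    {x₀ : EuclideanSpace ℝ (Fin n)} (hx₀ : ‖x₀‖ < 1) :
    ∃ ρ θ K : ℝ, 0 < ρ ∧ 0 < θ ∧ θ < 1 ∧ 0 < K ∧
      ∀ (u : EuclideanSpace ℝ (Fin n) → ℂ) (P : ℕ → MvPolynomial (Fin n) ℂ),
      AnalyticOnNhd ℝ u (ball 0 1) → IsLocalSum u P → (∀ k, (P k).IsHomogeneous k) →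
      (∀ k, polyLap^[p] (P k) = 0) → MemLp u 2 (volume.restrict (ball 0 1)) →
      ∀ k z, ‖z - c • cx x₀‖ ≤ ρ → ‖eval z (P k)‖ ^ 2 ≤ K * (θ ^ k) ^ 2 *
        ∫ y in ball (0 : EuclideanSpace ℝ (Fin n)) 1, ‖u y‖ ^ 2 := by
  -- In the squared estimate, homogeneity at `z = c σ⁴ w` gains `σ ^ (8k)`, the sup bound with `l =
  -- σ⁻²` costs `σ ^ (-2k)`, and the weighted norm with `t = σ` costs `σ ^ (-2k)`. What remains is
  -- `σ ^ (4k) = (θ ^ k)²` with `θ = σ²`.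
  obtain ⟨σ, hσ0, hσ1, hσ⟩ : ∃ σ : ℝ, 0 < σ ∧ σ < 1 ∧ ‖x₀‖ ≤ σ ^ 4 := by
    have h0 : 0 < (1 + ‖x₀‖) / 2 := by positivity
    refine ⟨((1 + ‖x₀‖) / 2) ^ (((4 : ℕ) : ℝ)⁻¹), by positivity,
      Real.rpow_lt_one h0.le (by linarith) (by positivity), ?_⟩
    rw [Real.rpow_inv_natCast_pow h0.le (by omega)]
    linarith
  obtain ⟨δ, C, hδ, hC, hpoly⟩ := exists_norm_eval_sq_le n (l := (σ ^ 2)⁻¹)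
    ((one_lt_inv₀ (by positivity)).2 (pow_lt_one₀ hσ0.le hσ1 two_ne_zero))
  obtain ⟨K, hK, hkey⟩ := exists_wnormSq_le n p hσ0 hσ1
  have hc0 : c ≠ 0 := norm_ne_zero_iff.1 (by rw [hc]; exact one_ne_zero)
  have hσc : (σ : ℂ) ≠ 0 := by exact_mod_cast hσ0.ne'
  refine ⟨σ ^ 4 * δ, σ ^ 2, C * K, by positivity, by positivity,
    pow_lt_one₀ hσ0.le hσ1 two_ne_zero, by positivity, fun u P hu hPu hP hPp huL k z hz => ?_⟩
  set w : Fin n → ℂ := (c * (σ ^ 4 : ℝ))⁻¹ • z with hw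
  have hzw : z = (c * (σ ^ 4 : ℝ)) • w := by
    rw [hw, smul_inv_smul₀]
    push_cast
    exact mul_ne_zero hc0 (pow_ne_zero _ hσc)
  have hwx : ‖w - cx ((σ ^ 4)⁻¹ • x₀)‖ ≤ δ := by
    have h1 : z - c • cx x₀ = (c * (σ ^ 4 : ℝ)) • (w - cx ((σ ^ 4)⁻¹ • x₀)) := by
      rw [smul_sub, ← hzw, cx_smul, smul_smul]
      congr 2
      push_cast
      field_simp
    rw [h1, norm_smul, norm_mul, hc, one_mul, Complex.norm_real, Real.norm_eq_abs,
      abs_of_pos (by positivity)] at hz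
    exact le_of_mul_le_mul_left hz (by positivity)
  have hx1 : ‖(σ ^ 4)⁻¹ • x₀‖ ≤ 1 := by
    rw [norm_smul, norm_inv, Real.norm_eq_abs, abs_of_pos (by positivity), inv_mul_le_iff₀
      (by positivity), mul_one]
    exact hσ
  have h1 := hpoly k (P k) (hP k) _ w hx1 hwx
  have h2 := hkey u P hu hPu hP hPp huL k
  rw [hzw, eval_smul_of_isHomogeneous (hP k), norm_mul, norm_pow, norm_mul, hc, one_mul,
    Complex.norm_real, Real.norm_eq_abs, abs_of_pos (by positivity), mul_pow]
  set I : ℝ := ∫ y in ball (0 : EuclideanSpace ℝ (Fin n)) 1, ‖u y‖ ^ 2 with hI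
  calc ((σ ^ 4) ^ k) ^ 2 * ‖eval w (P k)‖ ^ 2
      ≤ ((σ ^ 4) ^ k) ^ 2 * (C * ((σ ^ 2)⁻¹) ^ k * (K * ((σ ^ k)⁻¹) ^ 2 * I)) := by
        refine mul_le_mul_of_nonneg_left (h1.trans ?_) (by positivity)
        exact mul_le_mul_of_nonneg_left h2 (by positivity)
    _ = C * K * ((σ ^ 2) ^ k) ^ 2 * I := by
        have h3 : σ ^ k ≠ 0 := by positivity
        have e : (((σ ^ 4) ^ k) ^ 2 : ℝ) = ((σ ^ k) ^ 4) ^ 2 := by ring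
        have e2 : (((σ ^ 2)⁻¹) ^ k : ℝ) = ((σ ^ k) ^ 2)⁻¹ := by
          rw [inv_pow]; congr 1; ring
        have e3 : ((σ ^ 2) ^ k : ℝ) = (σ ^ k) ^ 2 := by ring
        rw [e, e2, e3]
        field_simp

end Components

section Cauchy

open scoped BoundedContinuousFunction Real

variable {n : ℕ}

/-! ### Sums of polynomials are analytic

We use the Cauchy integral formula on a polydisc, whose kernel is an analytic function with values
in the Banach algebra of bounded continuous functions. -/

/-- The measure on the parameter space of a torus. -/
def torusMeasure (n : ℕ) : Measure (Fin n → ℝ) :=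
  Measure.pi fun _ => volume.restrict (Ioc 0 (2 * π))

instance : IsFiniteMeasure (torusMeasure n) := by
  unfold torusMeasure; infer_instance

/-- Cauchy's formula for `z ^ m`, with `dz = i z dt` and `z / (z - w)` written as `(1 - w / z)⁻¹`,
the form that expands in a geometric series. -/
theorem integral_cauchy_pow {ρ : ℝ} (hρ : 0 < ρ) {w : ℂ} (hw : ‖w‖ < ρ) (m : ℕ) :
    ∫ t in Ioc 0 (2 * π), circleMap 0 ρ t ^ m * (1 - w * (circleMap 0 ρ t)⁻¹)⁻¹ =
      2 * π * w ^ m := by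
  have h := (differentiable_pow m : Differentiable ℂ fun z : ℂ => z ^ m).diffContOnCl
    (s := ball 0 ρ) |>.circleIntegral_sub_inv_smul (w := w) (by simpa using hw)
  rw [circleIntegral, intervalIntegral.integral_of_le Real.two_pi_pos.le] at h
  have h2 : ∀ t : ℝ, deriv (circleMap 0 ρ) t • ((circleMap 0 ρ t - w)⁻¹ • circleMap 0 ρ t ^ m) =
      Complex.I * (circleMap 0 ρ t ^ m * (1 - w * (circleMap 0 ρ t)⁻¹)⁻¹) := by
    intro t
    have h0 : circleMap 0 ρ t ≠ 0 := circleMap_ne_center hρ.ne'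
    have h3 : (1 - w * (circleMap 0 ρ t)⁻¹)⁻¹ = circleMap 0 ρ t * (circleMap 0 ρ t - w)⁻¹ := by
      have : 1 - w * (circleMap 0 ρ t)⁻¹ = (circleMap 0 ρ t - w) * (circleMap 0 ρ t)⁻¹ := by
        rw [sub_mul, mul_inv_cancel₀ h0]
      rw [this, mul_inv, inv_inv, mul_comm]
    rw [deriv_circleMap, h3]
    simp only [smul_eq_mul]
    ring
  simp only [h2] at h
  rw [integral_const_mul] at h
  refine mul_left_cancel₀ Complex.I_ne_zero (h.trans ?_)
  rw [smul_eq_mul]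
  ring

/-- The product of the factors of the Cauchy kernel of a polydisc. -/
def cauchyFactor (ρ : ℝ) (w : Fin n → ℂ) (t : Fin n → ℝ) : ℂ :=
  ∏ j, (1 - w j * (circleMap 0 ρ (t j))⁻¹)⁻¹

theorem norm_mul_inv_circleMap_lt {ρ : ℝ} (hρ : 0 < ρ) {w : ℂ} (hw : ‖w‖ < ρ) (t : ℝ) :
    ‖w * (circleMap 0 ρ t)⁻¹‖ < 1 := by
  rw [norm_mul, norm_inv, norm_circleMap_zero, abs_of_pos hρ, ← div_eq_mul_inv, div_lt_one hρ]
  exact hw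

theorem continuous_cauchyFactor {ρ : ℝ} (hρ : 0 < ρ) {w : Fin n → ℂ} (hw : ‖w‖ < ρ) :
    Continuous (cauchyFactor ρ w) := by
  refine continuous_finsetProd _ fun j _ => Continuous.inv₀ ?_ fun t ht => ?_
  · refine continuous_const.sub (continuous_const.mul (Continuous.inv₀ ?_ fun t =>
      circleMap_ne_center hρ.ne'))
    exact (continuous_circleMap 0 ρ).comp (continuous_apply j)
  · have h := norm_mul_inv_circleMap_lt hρ ((norm_le_pi_norm w j).trans_lt hw) (t j)
    rw [← sub_eq_zero.1 ht, norm_one] at h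
    exact lt_irrefl _ h

theorem norm_cauchyFactor_le {ρ : ℝ} (hρ : 0 < ρ) {w : Fin n → ℂ} (hw : ‖w‖ < ρ) (t : Fin n → ℝ) :
    ‖cauchyFactor ρ w t‖ ≤ ((1 - ‖w‖ / ρ)⁻¹) ^ n := by
  rw [cauchyFactor, norm_prod]
  have h0 : 0 < 1 - ‖w‖ / ρ := by rw [sub_pos, div_lt_one hρ]; exact hw
  refine (Finset.prod_le_prod (fun _ _ => norm_nonneg _) fun j _ =>
    (?_ : _ ≤ (1 - ‖w‖ / ρ)⁻¹)).trans_eq (by simp)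
  rw [norm_inv]
  refine inv_anti₀ h0 ?_
  have h1 := norm_sub_norm_le (1 : ℂ) (w j * (circleMap 0 ρ (t j))⁻¹)
  rw [norm_one, norm_mul, norm_inv, norm_circleMap_zero, abs_of_pos hρ, ← div_eq_mul_inv] at h1
  have h2 : ‖w j‖ / ρ ≤ ‖w‖ / ρ := div_le_div_of_nonneg_right (norm_le_pi_norm w j) hρ.le
  linarith

theorem continuous_eval_circleMap (ρ : ℝ) (P : MvPolynomial (Fin n) ℂ) :
    Continuous fun t : Fin n → ℝ => eval (fun j => circleMap 0 ρ (t j)) P :=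
  (continuous_eval P).comp (continuous_pi fun j =>
    (continuous_circleMap 0 ρ).comp (continuous_apply j))

theorem norm_circleMap_pi_le {ρ : ℝ} (hρ : 0 < ρ) (t : Fin n → ℝ) :
    ‖fun j => circleMap 0 ρ (t j)‖ ≤ ρ :=
  (pi_norm_le_iff_of_nonneg hρ.le).2 fun j => by
    rw [norm_circleMap_zero, abs_of_pos hρ]

theorem exists_bound_eval (P : MvPolynomial (Fin n) ℂ) (ρ : ℝ) :
    ∃ M, ∀ z : Fin n → ℂ, ‖z‖ ≤ ρ → ‖eval z P‖ ≤ M := by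
  obtain ⟨M, hM⟩ := (isCompact_closedBall (0 : Fin n → ℂ) ρ).exists_bound_of_continuousOn
    (continuous_eval P).continuousOn
  exact ⟨M, fun z hz => hM z (by simpa using hz)⟩

/-- The Cauchy integral formula on a polydisc, for polynomials. -/
theorem integral_eval_mul_cauchyFactor {ρ : ℝ} (hρ : 0 < ρ) {w : Fin n → ℂ} (hw : ‖w‖ < ρ)
    (P : MvPolynomial (Fin n) ℂ) :
    ∫ t, eval (fun j => circleMap 0 ρ (t j)) P * cauchyFactor ρ w t ∂torusMeasure n =
      (2 * π) ^ n * eval w P := by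
  have hint : ∀ Q : MvPolynomial (Fin n) ℂ, Integrable (fun t : Fin n → ℝ =>
      eval (fun j => circleMap 0 ρ (t j)) Q * cauchyFactor ρ w t) (torusMeasure n) := by
    intro Q
    obtain ⟨M, hM⟩ := exists_bound_eval Q ρ
    refine Integrable.of_bound ((continuous_eval_circleMap ρ Q).mul
      (continuous_cauchyFactor hρ hw)).aestronglyMeasurable (M * ((1 - ‖w‖ / ρ)⁻¹) ^ n)
      (Eventually.of_forall fun t => ?_)
    rw [norm_mul]
    have h1 := hM _ (norm_circleMap_pi_le hρ t)
    exact mul_le_mul h1 (norm_cauchyFactor_le hρ hw t) (norm_nonneg _) ((norm_nonneg _).trans h1)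
  induction P using MvPolynomial.induction_on' with
  | monomial d a =>
    -- For a monomial the integrand is a product of functions of one variable each.
    have h1 : ∀ t : Fin n → ℝ,
        eval (fun j => circleMap 0 ρ (t j)) (monomial d a) * cauchyFactor ρ w t =
        a * ∏ j, (circleMap 0 ρ (t j) ^ d j * (1 - w j * (circleMap 0 ρ (t j))⁻¹)⁻¹) := by
      intro t
      rw [eval_monomial, Finsupp.prod_fintype _ _ (by simp), cauchyFactor, mul_assoc,
        ← Finset.prod_mul_distrib]
    simp only [h1]
    rw [integral_const_mul, torusMeasure, integral_fintype_prod_eq_prod (fun (j : Fin n) (t : ℝ) =>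
      circleMap 0 ρ t ^ d j * (1 - w j * (circleMap 0 ρ t)⁻¹)⁻¹)]
    simp only [integral_cauchy_pow hρ ((norm_le_pi_norm w _).trans_lt hw)]
    rw [Finset.prod_mul_distrib, eval_monomial, Finsupp.prod_fintype _ _ (by simp)]
    simp
    ring
  | add P Q hP hQ =>
    simp only [map_add, add_mul]
    rw [integral_add (hint P) (hint Q), hP, hQ, mul_add]

/-- The function `t ↦ (ρ e^{i t_j})⁻¹` as a bounded continuous function. -/
def invCircle (ρ : ℝ) (hρ : 0 < ρ) (j : Fin n) : (Fin n → ℝ) →ᵇ ℂ :=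
  BoundedContinuousFunction.ofNormedAddCommGroup (fun t => (circleMap 0 ρ (t j))⁻¹)
    (Continuous.inv₀ ((continuous_circleMap 0 ρ).comp (continuous_apply j))
      fun _ => circleMap_ne_center hρ.ne') ρ⁻¹ fun t => by
    rw [norm_inv, norm_circleMap_zero, abs_of_pos hρ]

theorem norm_invCircle_le {ρ : ℝ} (hρ : 0 < ρ) (j : Fin n) : ‖invCircle ρ hρ j‖ ≤ ρ⁻¹ :=
  BoundedContinuousFunction.norm_ofNormedAddCommGroup_le _ (by positivity) _

/-- The Cauchy kernel of a polydisc, with values in the bounded continuous functions. -/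
def cauchyKernel (ρ : ℝ) (hρ : 0 < ρ) (w : Fin n → ℂ) : (Fin n → ℝ) →ᵇ ℂ :=
  ∏ j, Ring.inverse (1 - w j • invCircle ρ hρ j)

/-- Inversion near 1 is analytic in a complete normed algebra, and the kernel is a product of such
inverses of affine functions of `w`. Joint analyticity in all variables comes out at once. -/
theorem analyticAt_cauchyKernel {ρ : ℝ} (hρ : 0 < ρ) :
    AnalyticAt ℂ (cauchyKernel (n := n) ρ hρ) 0 := by
  unfold cauchyKernel
  refine Finset.analyticAt_fun_prod _ fun j _ => ?_
  have h1 : AnalyticAt ℂ (fun w : Fin n → ℂ => w j • invCircle ρ hρ j) 0 :=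
    ((ContinuousLinearMap.proj (R := ℂ) (φ := fun _ : Fin n => ℂ) j).smulRight
      (invCircle ρ hρ j)).analyticAt 0
  refine AnalyticAt.fun_comp (g := fun x : (Fin n → ℝ) →ᵇ ℂ => Ring.inverse (1 - x)) ?_ h1
  simpa using analyticAt_inverse_one_sub ℂ ((Fin n → ℝ) →ᵇ ℂ)

theorem cauchyKernel_apply {ρ : ℝ} (hρ : 0 < ρ) {w : Fin n → ℂ} (hw : ‖w‖ < ρ) (t : Fin n → ℝ) :
    cauchyKernel ρ hρ w t = cauchyFactor ρ w t := by
  have h : cauchyKernel ρ hρ w t = ∏ j, (Ring.inverse (1 - w j • invCircle ρ hρ j)) t := by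
    unfold cauchyKernel
    induction (Finset.univ : Finset (Fin n)) using Finset.induction_on with
    | empty => simp
    | insert a s ha ih => rw [Finset.prod_insert ha, Finset.prod_insert ha, ← ih]; rfl
  rw [h, cauchyFactor]
  refine Finset.prod_congr rfl fun j _ => ?_
  have h1 : ‖w j • invCircle ρ hρ j‖ < 1 := by
    rw [norm_smul]
    calc ‖w j‖ * ‖invCircle ρ hρ j‖ ≤ ‖w‖ * ρ⁻¹ :=
          mul_le_mul (norm_le_pi_norm w j) (norm_invCircle_le hρ j) (norm_nonneg _) (norm_nonneg _)
      _ < 1 := by rwa [← div_eq_mul_inv, div_lt_one hρ]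
  have h2 := Ring.inverse_mul_cancel _ (isUnit_one_sub_of_norm_lt_one h1)
  have h3 := congrArg (fun f : (Fin n → ℝ) →ᵇ ℂ => f t) h2
  exact eq_inv_of_mul_eq_one_left h3

/-- By Cauchy's formula applied termwise, the sum near 0 is, up to a constant, the pairing of its
values on the torus with the Cauchy kernel: a continuous linear functional composed with an analytic
map. -/
theorem analyticAt_tsum_eval_zero {P : ℕ → MvPolynomial (Fin n) ℂ} {ρ : ℝ} (hρ : 0 < ρ) {a : ℕ → ℝ}
    (ha : Summable a) (h : ∀ k z, ‖z‖ ≤ ρ → ‖eval z (P k)‖ ≤ a k) :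
    AnalyticAt ℂ (fun z : Fin n → ℂ => ∑' k, eval z (P k)) 0 := by
  let F : (Fin n → ℝ) → ℂ := fun t => ∑' k, eval (fun j => circleMap 0 ρ (t j)) (P k)
  have hFc : Continuous F := continuous_tsum (fun k => continuous_eval_circleMap ρ (P k)) ha
    fun k t => h k _ (norm_circleMap_pi_le hρ t)
  have hFi : Integrable F (torusMeasure n) := Integrable.of_bound hFc.aestronglyMeasurable (∑' k, a k)
    (Eventually.of_forall fun t => tsum_of_norm_bounded ha.hasSum
      fun k => h k _ (norm_circleMap_pi_le hρ t))
  have hFg : ∀ g : (Fin n → ℝ) →ᵇ ℂ, Integrable (fun t => F t * g t) (torusMeasure n) := fun g =>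
    hFi.mul_bdd (c := ‖g‖) g.continuous.aestronglyMeasurable
      (Eventually.of_forall fun t => g.norm_coe_le_norm t)
  let l : ((Fin n → ℝ) →ᵇ ℂ) →L[ℂ] ℂ := LinearMap.mkContinuous
    { toFun := fun g => ∫ t, F t * g t ∂torusMeasure n
      map_add' := fun g g' => by
        simp only [BoundedContinuousFunction.coe_add, Pi.add_apply, mul_add]
        exact integral_add (hFg g) (hFg g')
      map_smul' := fun c g => by
        simp only [BoundedContinuousFunction.coe_smul, smul_eq_mul, RingHom.id_apply,
          mul_left_comm _ c]
        exact integral_const_mul _ _ }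
    (∫ t, ‖F t‖ ∂torusMeasure n) fun g => by
      refine (norm_integral_le_of_norm_le (hFi.norm.mul_const ‖g‖)
        (Eventually.of_forall fun t => ?_)).trans_eq (integral_mul_const _ _)
      rw [norm_mul]
      exact mul_le_mul_of_nonneg_left (g.norm_coe_le_norm t) (norm_nonneg _)
  have hl : AnalyticAt ℂ (fun w : Fin n → ℂ => ((2 * π : ℂ) ^ n)⁻¹ * l (cauchyKernel ρ hρ w)) 0 :=
    analyticAt_const.mul ((l.analyticAt _).comp (analyticAt_cauchyKernel hρ))
  refine hl.congr ?_
  filter_upwards [ball_mem_nhds (0 : Fin n → ℂ) hρ] with w hw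
  rw [mem_ball_zero_iff] at hw
  have hsum : HasSum (fun k => (2 * π : ℂ) ^ n * eval w (P k)) (l (cauchyKernel ρ hρ w)) := by
    simp only [← integral_eval_mul_cauchyFactor hρ hw]
    refine hasSum_integral_of_dominated_convergence
      (fun k _ => a k * ((1 - ‖w‖ / ρ)⁻¹) ^ n) (fun k => ((continuous_eval_circleMap ρ (P k)).mul
        (continuous_cauchyFactor hρ hw)).aestronglyMeasurable) (fun k => ?_) ?_ ?_ ?_
    · refine Eventually.of_forall fun t => ?_
      rw [norm_mul]
      have h1 := h k _ (norm_circleMap_pi_le hρ t)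
      exact mul_le_mul h1 (norm_cauchyFactor_le hρ hw t) (norm_nonneg _) ((norm_nonneg _).trans h1)
    · exact Eventually.of_forall fun t => ha.mul_right _
    · exact integrable_const _
    · refine Eventually.of_forall fun t => ?_
      simp only [cauchyKernel_apply hρ hw]
      exact (Summable.of_norm_bounded ha fun k => h k _ (norm_circleMap_pi_le hρ t)).hasSum.mul_right _
  have h0 : ((2 * π : ℂ) ^ n) ≠ 0 := pow_ne_zero _ (by exact_mod_cast Real.two_pi_pos.ne')
  have h1 := hsum.mul_left ((2 * π : ℂ) ^ n)⁻¹
  simp only [inv_mul_cancel_left₀ h0] at h1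
  exact h1.tsum_eq.symm

theorem exists_eval_add (P : MvPolynomial (Fin n) ℂ) (c : Fin n → ℂ) :
    ∃ Q : MvPolynomial (Fin n) ℂ, ∀ z, eval z Q = eval (c + z) P := by
  induction P using MvPolynomial.induction_on with
  | C a => exact ⟨MvPolynomial.C a, by simp⟩
  | add P P' hP hP' =>
    obtain ⟨Q, hQ⟩ := hP
    obtain ⟨Q', hQ'⟩ := hP'
    exact ⟨Q + Q', by simp [hQ, hQ']⟩
  | mul_X P i hP =>
    obtain ⟨Q, hQ⟩ := hP
    exact ⟨Q * (MvPolynomial.C (c i) + X i), by simp [hQ]⟩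

/-- A series of polynomials that is normally convergent near a point of `ℂⁿ` is analytic there. -/
theorem analyticAt_tsum_eval {P : ℕ → MvPolynomial (Fin n) ℂ} {c : Fin n → ℂ} {ρ : ℝ} (hρ : 0 < ρ)
    {a : ℕ → ℝ} (ha : Summable a) (h : ∀ k z, ‖z - c‖ ≤ ρ → ‖eval z (P k)‖ ≤ a k) :
    AnalyticAt ℂ (fun z : Fin n → ℂ => ∑' k, eval z (P k)) c := by
  choose Q hQ using fun k => exists_eval_add (P k) c
  have h1 : AnalyticAt ℂ (fun z : Fin n → ℂ => ∑' k, eval z (Q k)) (c - c) := by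
    rw [sub_self]
    refine analyticAt_tsum_eval_zero hρ ha fun k z hz => ?_
    rw [hQ]
    exact h k _ (by simpa using hz)
  have h2 : AnalyticAt ℂ (fun z : Fin n → ℂ => z - c) c := analyticAt_id.sub analyticAt_const
  have h3 := AnalyticAt.fun_comp (f := fun z : Fin n → ℂ => z - c) h1 h2
  simpa only [hQ, add_sub_cancel] using h3

end Cauchy

section Continuation

variable {n : ℕ}

/-! ### The analytic continuation of a polyharmonic function -/

theorem ofLp_rot (θ : ℝ) (x : EuclideanSpace ℝ (Fin n)) :
    (rot θ x).ofLp = Complex.exp (θ * Complex.I) • cx x := rfl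

theorem ofLp_rot_zero (x : EuclideanSpace ℝ (Fin n)) : (rot 0 x).ofLp = cx x := by
  rw [ofLp_rot]; simp

theorem rot_sub (θ : ℝ) (x y : EuclideanSpace ℝ (Fin n)) : rot θ x - rot θ y = rot θ (x - y) := by
  ext j
  simp [rot, mul_sub]

theorem rot_smul (θ t : ℝ) (x : EuclideanSpace ℝ (Fin n)) : rot θ (t • x) = t • rot θ x := by
  ext j
  simp [rot, mul_left_comm]

theorem norm_rot (θ : ℝ) (x : EuclideanSpace ℝ (Fin n)) : ‖rot θ x‖ = ‖x‖ := by
  rw [EuclideanSpace.norm_eq, EuclideanSpace.norm_eq]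
  simp [rot, Complex.norm_exp_ofReal_mul_I]

theorem isometry_rot (θ : ℝ) : Isometry (rot θ : EuclideanSpace ℝ (Fin n) → _) :=
  Isometry.of_dist_eq fun x y => by rw [dist_eq_norm, dist_eq_norm, rot_sub, norm_rot]

theorem rot_mem_allRotations (θ : ℝ) {x : EuclideanSpace ℝ (Fin n)} (hx : ‖x‖ < 1) :
    rot θ x ∈ allRotations n :=
  mem_iUnion.2 ⟨θ, x, by simpa [unitBall] using hx, rfl⟩

theorem zero_mem_allRotations : (0 : EuclideanSpace ℂ (Fin n)) ∈ allRotations n := by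
  have := rot_mem_allRotations (n := n) 0 (x := 0) (by simp)
  have h0 : rot 0 (0 : EuclideanSpace ℝ (Fin n)) = 0 := by
    rw [← norm_eq_zero, norm_rot, norm_zero]
  rwa [h0] at this

/-- The set is star-shaped about the origin. -/
theorem isPreconnected_allRotations : IsPreconnected (allRotations n) := by
  have h : StarConvex ℝ 0 (allRotations n) := by
    rw [starConvex_zero_iff]
    rintro z hz t ht0 ht1
    obtain ⟨θ, x, hx, rfl⟩ := mem_iUnion.1 hz
    rw [unitBall, mem_ball_zero_iff] at hx
    rw [← rot_smul]
    refine rot_mem_allRotations θ ?_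
    rw [norm_smul, Real.norm_eq_abs, abs_of_nonneg ht0]
    nlinarith [norm_nonneg x]
  exact (h.isPathConnected zero_mem_allRotations).isConnected.isPreconnected

/-- A holomorphic function near `0` that vanishes at the real points vanishes near `0`. -/
theorem eventuallyEq_zero_of_real {W : EuclideanSpace ℂ (Fin n) → ℂ} (hW : AnalyticAt ℂ W 0)
    (h : ∀ᶠ x : EuclideanSpace ℝ (Fin n) in 𝓝 0, W (rot 0 x) = 0) : W =ᶠ[𝓝 0] 0 := by
  obtain ⟨δ, hδ, hδW⟩ := Metric.eventually_nhds_iff_ball.1 hW.eventually_analyticAt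
  obtain ⟨δ', hδ', hδW'⟩ := Metric.eventually_nhds_iff_ball.1 h
  set ε := min δ δ' / 4 with hε
  have hε0 : 0 < ε := by positivity
  filter_upwards [ball_mem_nhds _ hε0] with z hz
  rw [mem_ball_zero_iff] at hz
  let X : EuclideanSpace ℝ (Fin n) := WithLp.toLp 2 fun i => (z i).re
  let Y : EuclideanSpace ℝ (Fin n) := WithLp.toLp 2 fun i => (z i).im
  have hX : ‖X‖ < ε := by
    refine lt_of_le_of_lt ?_ hz
    rw [EuclideanSpace.norm_eq, EuclideanSpace.norm_eq]
    refine Real.sqrt_le_sqrt (Finset.sum_le_sum fun i _ => pow_le_pow_left₀ (norm_nonneg _) ?_ 2)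
    exact Complex.abs_re_le_norm (z i)
  have hY : ‖Y‖ < ε := by
    refine lt_of_le_of_lt ?_ hz
    rw [EuclideanSpace.norm_eq, EuclideanSpace.norm_eq]
    refine Real.sqrt_le_sqrt (Finset.sum_le_sum fun i _ => pow_le_pow_left₀ (norm_nonneg _) ?_ 2)
    exact Complex.abs_im_le_norm (z i)
  -- With `z = X + iY`, the function `w ↦ W (X + w Y)` is holomorphic for `|w| < 2` and vanishes for
  -- real `w` near 0, hence at `w = i`.
  let g : ℂ → ℂ := fun w => W (rot 0 X + w • rot 0 Y)
  have hg : AnalyticOnNhd ℂ g (ball 0 2) := by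
    intro w hw
    rw [mem_ball_zero_iff] at hw
    refine AnalyticAt.fun_comp (g := W) (f := fun w : ℂ => rot 0 X + w • rot 0 Y) (hδW _ ?_)
      (analyticAt_const.add (analyticAt_id.smul analyticAt_const))
    rw [mem_ball_zero_iff]
    refine (norm_add_le _ _).trans_lt ?_
    rw [norm_smul, norm_rot, norm_rot]
    have h1 : ‖w‖ * ‖Y‖ ≤ 2 * ε := mul_le_mul hw.le hY.le (norm_nonneg _) (by norm_num)
    have h2 : 4 * ε ≤ δ := by rw [hε]; linarith [min_le_left δ δ']
    linarith
  have hz' : rot 0 X + Complex.I • rot 0 Y = z := by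
    ext i
    simp only [rot, Complex.ofReal_zero, zero_mul, Complex.exp_zero, one_mul, PiLp.add_apply,
      PiLp.smul_apply, smul_eq_mul, X, Y]
    rw [mul_comm]
    exact Complex.re_add_im (z i)
  have hzero := hg.eqOn_zero_of_preconnected_of_frequently_eq_zero (convex_ball _ _).isPreconnected
    (mem_ball_self two_pos) ?_
  · have := hzero (show Complex.I ∈ ball (0 : ℂ) 2 by simp)
    simp only [g, hz'] at this
    exact this
  · have ht : Tendsto (fun t : ℝ => (t : ℂ)) (𝓝[≠] 0) (𝓝[≠] 0) := by
      refine tendsto_nhdsWithin_of_tendsto_nhds_of_eventually_within _ ?_ ?_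
      · exact (Complex.continuous_ofReal.tendsto' 0 0 Complex.ofReal_zero).mono_left
          nhdsWithin_le_nhds
      · filter_upwards [self_mem_nhdsWithin] with t ht
        simpa using ht
    refine ht.frequently (Eventually.frequently ?_)
    have h1 : ∀ᶠ t : ℝ in 𝓝[≠] 0, |t| < 1 :=
      nhdsWithin_le_nhds ((continuous_abs.tendsto' 0 0 abs_zero).eventually (gt_mem_nhds one_pos))
    filter_upwards [h1] with t ht
    have h2 : rot 0 X + (t : ℂ) • rot 0 Y = rot 0 (X + t • Y) := by
      ext i
      simp [rot]
    simp only [g, h2]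
    refine hδW' _ ?_
    rw [mem_ball_zero_iff]
    refine (norm_add_le _ _).trans_lt ?_
    rw [norm_smul, Real.norm_eq_abs]
    have h3 : |t| * ‖Y‖ ≤ 1 * ε := mul_le_mul ht.le hY.le (norm_nonneg _) (by norm_num)
    have h2 : 4 * ε ≤ δ' := by rw [hε]; linarith [min_le_right δ δ']
    linarith

theorem IsContinuation.eqOn {u : EuclideanSpace ℝ (Fin n) → ℂ} {U V : EuclideanSpace ℂ (Fin n) → ℂ}
    (hU : IsContinuation u U) (hV : IsContinuation u V) : EqOn U V (allRotations n) := by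
  refine hU.1.eqOn_of_preconnected_of_eventuallyEq hV.1 isPreconnected_allRotations
    zero_mem_allRotations ?_
  have h := eventuallyEq_zero_of_real (W := U - V)
    ((hU.1 0 zero_mem_allRotations).sub (hV.1 0 zero_mem_allRotations)) ?_
  · filter_upwards [h] with z hz
    exact sub_eq_zero.1 hz
  · filter_upwards [ball_mem_nhds (0 : EuclideanSpace ℝ (Fin n)) one_pos] with x hx
    rw [Pi.sub_apply, hU.2 x hx, hV.2 x hx, sub_self]

/-- The sum of a series of polynomials, as a function on `ℂⁿ`. -/
def seriesSum (P : ℕ → MvPolynomial (Fin n) ℂ) (z : EuclideanSpace ℂ (Fin n)) : ℂ :=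
  ∑' k, eval z.ofLp (P k)

theorem analyticAt_seriesSum {P : ℕ → MvPolynomial (Fin n) ℂ} {z₀ : EuclideanSpace ℂ (Fin n)}
    {ρ : ℝ} (hρ : 0 < ρ) {a : ℕ → ℝ} (ha : Summable a)
    (h : ∀ k z, ‖z - z₀.ofLp‖ ≤ ρ → ‖eval z (P k)‖ ≤ a k) : AnalyticAt ℂ (seriesSum P) z₀ :=
  AnalyticAt.fun_comp (g := fun z : Fin n → ℂ => ∑' k, eval z (P k))
    (f := fun z : EuclideanSpace ℂ (Fin n) => z.ofLp) (analyticAt_tsum_eval hρ ha h)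
    ((EuclideanSpace.equiv (Fin n) ℂ).toContinuousLinearMap.analyticAt z₀)

/-- The inclusion of `ℝⁿ` into `ℂⁿ` as a real-linear map. -/
def rotZeroL (n : ℕ) : EuclideanSpace ℝ (Fin n) →L[ℝ] EuclideanSpace ℂ (Fin n) :=
  LinearMap.toContinuousLinearMap
    { toFun := rot 0
      map_add' := fun x y => by ext j; simp [rot]
      map_smul' := fun t x => rot_smul 0 t x }

theorem analyticAt_comp_rot_zero {U : EuclideanSpace ℂ (Fin n) → ℂ} {x : EuclideanSpace ℝ (Fin n)}
    (hU : AnalyticAt ℂ U (rot 0 x)) : AnalyticAt ℝ (fun x => U (rot 0 x)) x :=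
  AnalyticAt.fun_comp (g := U) (f := fun x => rotZeroL n x) (hU.restrictScalars (𝕜 := ℝ))
    ((rotZeroL n).analyticAt x)

theorem IsLocalSum.dilation {u : EuclideanSpace ℝ (Fin n) → ℂ} {P : ℕ → MvPolynomial (Fin n) ℂ}
    (h : IsLocalSum u P) (hP : ∀ k, (P k).IsHomogeneous k) {r : ℝ} (hr0 : 0 < r) (hr1 : r < 1) :
    IsLocalSum (fun x => u (r • x)) fun k => (r : ℂ) ^ k • P k := by
  obtain ⟨ρ, C, hρ, h1, h2⟩ := h
  have hr : ‖(r : ℂ)‖ = r := by rw [Complex.norm_real, Real.norm_eq_abs, abs_of_pos hr0]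
  have e : ∀ k z, eval z ((r : ℂ) ^ k • P k) = eval ((r : ℂ) • z) (P k) := fun k z => by
    rw [smul_eval, eval_smul_of_isHomogeneous (hP k)]
  refine ⟨ρ, C, hρ, fun k z hz => ?_, fun x hx => ?_⟩
  · rw [e]
    refine h1 k _ ?_
    rw [norm_smul, hr]
    nlinarith [norm_nonneg z]
  · simp only [e, ← cx_smul]
    refine h2 _ ?_
    rw [norm_smul, Real.norm_eq_abs, abs_of_pos hr0]
    nlinarith [norm_nonneg x]

theorem polyLap_iterate_eq_pow (p : ℕ) (P : MvPolynomial (Fin n) ℂ) :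
    polyLap^[p] P = (polyLap ^ p) P := by
  rw [Module.End.pow_apply]

/-- The series of homogeneous components of a polyharmonic function converges normally near each
point of the rotated balls. -/
theorem exists_summable_bound {p : ℕ} {u : EuclideanSpace ℝ (Fin n) → ℂ}
    {P : ℕ → MvPolynomial (Fin n) ℂ} (hu : AnalyticOnNhd ℝ u (ball 0 1)) (hPu : IsLocalSum u P)
    (hP : ∀ k, (P k).IsHomogeneous k) (hPp : ∀ k, polyLap^[p] (P k) = 0) {c : ℂ} (hc : ‖c‖ = 1)
    {x₀ : EuclideanSpace ℝ (Fin n)} (hx₀ : ‖x₀‖ < 1) :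
    ∃ (ρ : ℝ) (a : ℕ → ℝ), 0 < ρ ∧ Summable a ∧
      ∀ k z, ‖z - c • cx x₀‖ ≤ ρ → ‖eval z (P k)‖ ≤ a k := by
  -- Here `u` need not be square-integrable, but `u(r ·)` is. Its components are `r ^ k P k`, and
  -- the estimate is used at `x₀ / r`, still inside the ball.
  obtain ⟨r, hr1, hr2⟩ := exists_between hx₀
  have hr0 : 0 < r := (norm_nonneg _).trans_lt hr1
  have hrc : (r : ℂ) ≠ 0 := by exact_mod_cast hr0.ne'
  have hx1 : ‖r⁻¹ • x₀‖ < 1 := by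
    rw [norm_smul, norm_inv, Real.norm_eq_abs, abs_of_pos hr0, inv_mul_lt_iff₀ hr0, mul_one]
    exact hr1
  obtain ⟨ρ, θ, K, hρ, hθ0, hθ1, hK, h⟩ := exists_norm_eval_component_sq_le p hc hx1
  have hur : AnalyticOnNhd ℝ (fun x => u (r • x)) (ball 0 1) := fun x hx => by
    refine AnalyticAt.fun_comp (g := u) (f := fun x => r • x) (hu _ ?_)
      ((r • ContinuousLinearMap.id ℝ (EuclideanSpace ℝ (Fin n))).analyticAt x)
    rw [mem_ball_zero_iff] at hx ⊢
    rw [norm_smul, Real.norm_eq_abs, abs_of_pos hr0]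
    nlinarith [norm_nonneg x]
  have hb := h (fun x => u (r • x)) (fun k => (r : ℂ) ^ k • P k) hur (hPu.dilation hP hr0 hr2)
    (fun k => (homogeneousSubmodule (Fin n) ℂ k).smul_mem _ (hP k))
    (fun k => by
      rw [polyLap_iterate_eq_pow, map_smul, ← polyLap_iterate_eq_pow, hPp, smul_zero])
    (memLp_dilation hu.continuousOn (by rwa [abs_of_pos hr0]))
  set I : ℝ := ∫ y in ball (0 : EuclideanSpace ℝ (Fin n)) 1, ‖u (r • y)‖ ^ 2 with hI
  have hI0 : 0 ≤ I := integral_nonneg fun _ => by positivity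
  refine ⟨r * ρ, fun k => √(K * I) * θ ^ k, by positivity,
    (summable_geometric_of_lt_one hθ0.le hθ1).mul_left _, fun k z hz => ?_⟩
  have h1 : ‖(r : ℂ)⁻¹ • z - c • cx (r⁻¹ • x₀)‖ ≤ ρ := by
    have h2 : z - c • cx x₀ = (r : ℂ) • ((r : ℂ)⁻¹ • z - c • cx (r⁻¹ • x₀)) := by
      rw [smul_sub, smul_inv_smul₀ hrc, cx_smul, smul_comm c, Complex.ofReal_inv,
        smul_inv_smul₀ hrc]
    rw [h2, norm_smul, Complex.norm_real, Real.norm_eq_abs, abs_of_pos hr0] at hz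
    exact le_of_mul_le_mul_left hz hr0
  have h2 := hb k _ h1
  rw [smul_eval, ← eval_smul_of_isHomogeneous (hP k), smul_inv_smul₀ hrc] at h2
  refine le_of_sq_le_sq ?_ (by positivity)
  rw [mul_pow, Real.sq_sqrt (by positivity)]
  linarith

theorem norm_exp_mul_I (ψ : ℝ) : ‖Complex.exp (ψ * Complex.I)‖ = 1 :=
  Complex.norm_exp_ofReal_mul_I ψ

/-- Normal convergence gives analyticity near each rotated ball. Agreement with `u`, known near the
origin, spreads over the real ball by analyticity. -/
theorem isContinuation_seriesSum {p : ℕ} {u : EuclideanSpace ℝ (Fin n) → ℂ}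
    {P : ℕ → MvPolynomial (Fin n) ℂ} (hu : AnalyticOnNhd ℝ u (ball 0 1)) (hPu : IsLocalSum u P)
    (hP : ∀ k, (P k).IsHomogeneous k) (hPp : ∀ k, polyLap^[p] (P k) = 0) :
    IsContinuation u (seriesSum P) := by
  have ha : AnalyticOnNhd ℂ (seriesSum P) (allRotations n) := by
    intro z hz
    obtain ⟨ψ, x, hx, rfl⟩ := mem_iUnion.1 hz
    rw [unitBall, mem_ball_zero_iff] at hx
    obtain ⟨ρ, a, hρ, ha, hb⟩ := exists_summable_bound hu hPu hP hPp (norm_exp_mul_I ψ) hx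
    exact analyticAt_seriesSum hρ ha fun k z hz => hb k z (by rwa [ofLp_rot] at hz)
  refine ⟨ha, ?_⟩
  have h1 : AnalyticOnNhd ℝ (fun x => seriesSum P (rot 0 x)) (ball 0 1) := fun x hx =>
    analyticAt_comp_rot_zero (ha _ (rot_mem_allRotations 0 (by simpa using hx)))
  refine h1.eqOn_of_preconnected_of_eventuallyEq hu (convex_ball _ _).isPreconnected
    (mem_ball_self one_pos) ?_
  obtain ⟨ρ, C, hρ, -, h2⟩ := hPu
  filter_upwards [closedBall_mem_nhds (0 : EuclideanSpace ℝ (Fin n)) hρ] with x hx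
  rw [seriesSum, ofLp_rot_zero]
  exact (h2 x (by simpa using hx)).tsum_eq

theorem exists_components {p : ℕ} {u : EuclideanSpace ℝ (Fin n) → ℂ}
    (hu : IsPolyharmonicOn p u (unitBall n)) :
    ∃ P : ℕ → MvPolynomial (Fin n) ℂ, (∀ k, (P k).IsHomogeneous k) ∧ IsLocalSum u P ∧
      ∀ k, polyLap^[p] (P k) = 0 := by
  obtain ⟨P, hP, hPu⟩ := exists_isLocalSum (hu.1 0 (mem_ball_self one_pos))
  simp only [zero_add] at hPu
  exact ⟨P, hP, hPu, (isPolyharmonicOn_iff hu.1 hPu hP).1 hu⟩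

theorem exists_unique_continuation {p : ℕ} {u : EuclideanSpace ℝ (Fin n) → ℂ}
    (hu : IsPolyharmonicOn p u (unitBall n)) :
    ∃ U, IsContinuation u U ∧ ∀ V, IsContinuation u V → EqOn V U (allRotations n) := by
  obtain ⟨P, hP, hPu, hPp⟩ := exists_components hu
  have h := isContinuation_seriesSum hu.1 hPu hP hPp
  exact ⟨_, h, fun V hV => hV.eqOn h⟩

end Continuation

section Bergman

variable {n p : ℕ}

/-! ### The measure on the union of the rotated balls -/

theorem measurableEmbedding_rot (θ : ℝ) :
    MeasurableEmbedding (rot θ : EuclideanSpace ℝ (Fin n) → EuclideanSpace ℂ (Fin n)) :=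
  (isometry_rot θ).isClosedEmbedding.measurableEmbedding

theorem ae_measureHat_iff {q : EuclideanSpace ℂ (Fin n) → Prop} :
    (∀ᵐ z ∂measureHat n p, q z) ↔
      ∀ k < p, ∀ᵐ y ∂volume.restrict (unitBall n), q (rot (angle p k) y) := by
  have h0 : (p : ℝ≥0∞)⁻¹ ≠ 0 := ENNReal.inv_ne_zero.2 (ENNReal.natCast_ne_top p)
  simp only [← (measurableEmbedding_rot _).ae_map_iff]
  simp only [ae_iff, measureHat, Measure.smul_apply, Measure.finsetSum_apply, smul_eq_mul,
    mul_eq_zero, h0, false_or, Finset.sum_eq_zero_iff, Finset.mem_range]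

theorem angle_zero (p : ℕ) : angle p 0 = 0 := by simp [angle]

theorem integrable_comp_rot {E : Type*} [NormedAddCommGroup E] {F : EuclideanSpace ℂ (Fin n) → E}
    (hp : 1 ≤ p) (hF : Integrable F (measureHat n p)) {k : ℕ} (hk : k < p) :
    Integrable (fun y => F (rot (angle p k) y)) (volume.restrict (unitBall n)) := by
  rw [measureHat, integrable_smul_measure (ENNReal.inv_ne_zero.2 (ENNReal.natCast_ne_top p))
    (ENNReal.inv_ne_top.2 (by exact_mod_cast (by omega : p ≠ 0))),
    integrable_finsetSum_measure] at hF
  exact (measurableEmbedding_rot _).integrable_map_iff.1 (hF k (Finset.mem_range.2 hk))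

theorem integral_measureHat {E : Type*} [NormedAddCommGroup E] [NormedSpace ℝ E]
    {F : EuclideanSpace ℂ (Fin n) → E} (hp : 1 ≤ p) (hF : Integrable F (measureHat n p)) :
    ∫ z, F z ∂measureHat n p =
      (p : ℝ)⁻¹ • ∑ k ∈ Finset.range p, ∫ y in unitBall n, F (rot (angle p k) y) := by
  rw [measureHat, integral_smul_measure, integral_finsetSum_measure]
  · simp only [(measurableEmbedding_rot _).integral_map, ENNReal.toReal_inv, ENNReal.toReal_natCast]
  · intro k hk
    exact (measurableEmbedding_rot _).integrable_map_iff.2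
      (integrable_comp_rot hp hF (Finset.mem_range.1 hk))

theorem memLp_comp_rot_zero {U : EuclideanSpace ℂ (Fin n) → ℂ} (hp : 1 ≤ p)
    (hU : MemLp U 2 (measureHat n p)) :
    MemLp (fun y => U (rot 0 y)) 2 (volume.restrict (unitBall n)) := by
  have hp0 : (p : ℝ≥0∞) ≠ 0 := by exact_mod_cast (by omega : p ≠ 0)
  have h : MemLp U 2 (Measure.map (rot (angle p 0)) (volume.restrict (unitBall n))) := by
    refine hU.of_measure_le_smul (ENNReal.natCast_ne_top p) ?_
    rw [measureHat, smul_smul, ENNReal.mul_inv_cancel hp0 (ENNReal.natCast_ne_top p), one_smul]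
    exact Finset.single_le_sum (f := fun k => Measure.map (rot (angle p k))
      (volume.restrict (unitBall n))) (fun _ _ => Measure.zero_le _) (Finset.mem_range.2 (by omega))
  rw [angle_zero] at h
  exact (measurableEmbedding_rot 0).memLp_map_measure_iff.1 h

/-- The real ball is the term of index 0 in the average, with weight `1 / p`. The bounds on
components see the norm only through this trace. -/
theorem integral_norm_sq_trace_le {U : EuclideanSpace ℂ (Fin n) → ℂ} (hp : 1 ≤ p)
    (hU : MemLp U 2 (measureHat n p)) :
    ∫ y in unitBall n, ‖U (rot 0 y)‖ ^ 2 ≤ p * ∫ z, ‖U z‖ ^ 2 ∂measureHat n p := by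
  have hp0 : (p : ℝ) ≠ 0 := by exact_mod_cast (by omega : p ≠ 0)
  rw [integral_measureHat hp hU.norm.integrable_sq, smul_eq_mul, mul_inv_cancel_left₀ hp0]
  have := Finset.single_le_sum (s := Finset.range p)
    (f := fun k => ∫ y in unitBall n, ‖U (rot (angle p k) y)‖ ^ 2)
    (fun k _ => integral_nonneg fun _ => by positivity) (Finset.mem_range.2 (by omega : 0 < p))
  simpa only [angle_zero] using this

theorem ballHat_subset_allRotations : ballHat n p ⊆ allRotations n := by
  intro z hz
  simp only [ballHat, mem_iUnion] at hz
  obtain ⟨k, -, hz⟩ := hz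
  exact mem_iUnion.2 ⟨_, hz⟩

theorem ae_mem_allRotations : ∀ᵐ z ∂measureHat n p, z ∈ allRotations n := by
  rw [ae_measureHat_iff]
  intro k _
  filter_upwards [ae_restrict_mem measurableSet_ball] with y hy
  exact mem_iUnion.2 ⟨_, y, hy, rfl⟩

theorem inner_eq_avgInner (hp : 1 ≤ p) (f g : L2Hat n p) : inner ℂ g f = avgInner n p f g := by
  have h : ∀ a, inner ℂ (g a) (f a) = f a * conj (g a) := fun a => RCLike.inner_apply _ _
  have hi : Integrable (fun a => f a * conj (g a)) (measureHat n p) := by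
    simpa only [h] using L2.integrable_inner (𝕜 := ℂ) g f
  rw [L2.inner_def]
  simp only [h]
  rw [integral_measureHat hp hi, avgInner, Complex.real_smul]
  push_cast
  rw [one_div]

theorem avgInner_congr {f f' g g' : EuclideanSpace ℂ (Fin n) → ℂ} (hf : f =ᵐ[measureHat n p] f')
    (hg : g =ᵐ[measureHat n p] g') : avgInner n p f g = avgInner n p f' g' := by
  rw [avgInner, avgInner]
  congr 1
  refine Finset.sum_congr rfl fun k hk => integral_congr_ae ?_
  filter_upwards [ae_measureHat_iff.1 hf k (Finset.mem_range.1 hk),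
    ae_measureHat_iff.1 hg k (Finset.mem_range.1 hk)] with y h1 h2
  rw [h1, h2]

theorem norm_sq_eq_integral {α : Type*} [MeasurableSpace α] {μ : Measure α} (f : Lp ℂ 2 μ) :
    ‖f‖ ^ 2 = ∫ z, ‖f z‖ ^ 2 ∂μ := by
  have h := inner_self_eq_norm_sq_to_K (𝕜 := ℂ) f
  rw [L2.inner_def] at h
  simp only [inner_self_eq_norm_sq_to_K] at h
  have h2 : ∫ z, ((‖f z‖ : ℂ)) ^ 2 ∂μ = ((∫ z, ‖f z‖ ^ 2 ∂μ : ℝ) : ℂ) := by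
    rw [← integral_complex_ofReal]
    simp
  exact Complex.ofReal_injective (by simpa using h.symm.trans h2)

/-! ### Homogeneous components of Bergman functions -/

/-- `U` is the sum on the rotated balls of the homogeneous polyharmonic polynomials `P k`. -/
structure HasComponents (p : ℕ) (U : EuclideanSpace ℂ (Fin n) → ℂ)
    (P : ℕ → MvPolynomial (Fin n) ℂ) : Prop where
  isHomogeneous : ∀ k, (P k).IsHomogeneous k
  polyLap_eq_zero : ∀ k, polyLap^[p] (P k) = 0
  analyticOnNhd : AnalyticOnNhd ℝ (fun x => U (rot 0 x)) (unitBall n)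
  isLocalSum : IsLocalSum (fun x => U (rot 0 x)) P

theorem IsBergmanFunction.exists_hasComponents {U : EuclideanSpace ℂ (Fin n) → ℂ}
    (hU : IsBergmanFunction n p U) : ∃ P, HasComponents p U P := by
  obtain ⟨⟨u, hu, huU⟩, -⟩ := hU
  obtain ⟨P, hP, hPu, hPp⟩ := exists_components hu
  have huU' : u =ᶠ[𝓝 0] fun x => U (rot 0 x) := by
    filter_upwards [ball_mem_nhds (0 : EuclideanSpace ℝ (Fin n)) one_pos] with x hx
    exact (huU.2 x hx).symm
  refine ⟨P, hP, hPp, fun x hx => ?_, hPu.congr huU'⟩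
  refine analyticAt_comp_rot_zero (huU.1 _ (rot_mem_allRotations 0 ?_))
  simpa [unitBall] using hx

theorem HasComponents.smul_add {U V : EuclideanSpace ℂ (Fin n) → ℂ}
    {P Q : ℕ → MvPolynomial (Fin n) ℂ} (a : ℂ) (hU : HasComponents p U P)
    (hV : HasComponents p V Q) : HasComponents p (a • U + V) fun k => a • P k + Q k where
  isHomogeneous k :=
    ((homogeneousSubmodule (Fin n) ℂ k).smul_mem _ (hU.isHomogeneous k)).add (hV.isHomogeneous k)
  polyLap_eq_zero k := by
    have h1 := hU.polyLap_eq_zero k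
    have h2 := hV.polyLap_eq_zero k
    rw [polyLap_iterate_eq_pow] at h1 h2 ⊢
    rw [map_add, map_smul, h1, h2, smul_zero, add_zero]
  analyticOnNhd x hx :=
    ((hU.analyticOnNhd x hx).const_smul (c := a)).add (hV.analyticOnNhd x hx)
  isLocalSum := (hU.isLocalSum.const_smul a).add hV.isLocalSum

theorem IsBergmanFunction.isContinuation {U : EuclideanSpace ℂ (Fin n) → ℂ}
    (hU : IsBergmanFunction n p U) : IsContinuation (fun x => U (rot 0 x)) U := by
  obtain ⟨⟨u, hu, huU⟩, -⟩ := hU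
  exact ⟨huU.1, fun _ _ => rfl⟩

/-- The components record the expansion only near the origin; uniqueness of continuations carries it
to all rotated balls. -/
theorem HasComponents.eqOn {U : EuclideanSpace ℂ (Fin n) → ℂ} {P : ℕ → MvPolynomial (Fin n) ℂ}
    (hP : HasComponents p U P) (hU : IsBergmanFunction n p U) :
    EqOn U (seriesSum P) (allRotations n) :=
  hU.isContinuation.eqOn (isContinuation_seriesSum hP.analyticOnNhd hP.isLocalSum
    hP.isHomogeneous hP.polyLap_eq_zero)

/-- The homogeneous components of a Bergman function are bounded near each point of the rotated
balls by the norm of the function. -/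
theorem exists_norm_eval_component_le (hp : 1 ≤ p) {z₀ : EuclideanSpace ℂ (Fin n)}
    (hz₀ : z₀ ∈ allRotations n) :
    ∃ ρ θ K : ℝ, 0 < ρ ∧ 0 < θ ∧ θ < 1 ∧ 0 < K ∧ ∀ U P, IsBergmanFunction n p U →
      HasComponents p U P → ∀ k z, ‖z - z₀.ofLp‖ ≤ ρ →
        ‖eval z (P k)‖ ≤ K * √(∫ z, ‖U z‖ ^ 2 ∂measureHat n p) * θ ^ k := by
  obtain ⟨ψ, x, hx, rfl⟩ := mem_iUnion.1 hz₀
  rw [unitBall, mem_ball_zero_iff] at hx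
  obtain ⟨ρ, θ, K, hρ, hθ0, hθ1, hK, h⟩ :=
    exists_norm_eval_component_sq_le (n := n) p (norm_exp_mul_I ψ) hx
  have hp0 : (0 : ℝ) < p := by exact_mod_cast hp
  refine ⟨ρ, θ, √(K * p), hρ, hθ0, hθ1, by positivity, fun U P hU hP k z hz => ?_⟩
  have hI0 : 0 ≤ ∫ z, ‖U z‖ ^ 2 ∂measureHat n p := integral_nonneg fun _ => by positivity
  have h1 := h _ P hP.analyticOnNhd hP.isLocalSum hP.isHomogeneous hP.polyLap_eq_zero
    (memLp_comp_rot_zero hp hU.2) k z hz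
  have h2 := integral_norm_sq_trace_le hp hU.2
  refine le_of_sq_le_sq ?_ (by positivity)
  rw [mul_pow, mul_pow, Real.sq_sqrt (by positivity), Real.sq_sqrt hI0]
  refine (h1.trans (mul_le_mul_of_nonneg_left h2 (by positivity))).trans_eq ?_
  ring

/-- Point evaluations are bounded on the Bergman space. -/
theorem exists_norm_apply_le (hp : 1 ≤ p) {z : EuclideanSpace ℂ (Fin n)}
    (hz : z ∈ allRotations n) :
    ∃ K : ℝ, 0 < K ∧ ∀ U, IsBergmanFunction n p U →
      ‖U z‖ ≤ K * √(∫ z, ‖U z‖ ^ 2 ∂measureHat n p) := by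
  obtain ⟨ρ, θ, K, hρ, hθ0, hθ1, hK, h⟩ := exists_norm_eval_component_le (n := n) hp hz
  refine ⟨K * (1 - θ)⁻¹, mul_pos hK (inv_pos.2 (by linarith)), fun U hU => ?_⟩
  obtain ⟨P, hP⟩ := hU.exists_hasComponents
  rw [hP.eqOn hU hz, seriesSum]
  refine (tsum_of_norm_bounded ((hasSum_geometric_of_lt_one hθ0.le hθ1).mul_left _)
    fun k => h U P hU hP k _ (by simpa using hρ.le)).trans_eq ?_
  ring

/-- The difference has norm zero, and point evaluations are bounded by the norm. Point values are
thus well defined on classes in `L²`. -/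
theorem IsBergmanFunction.eqOn_of_ae_eq (hp : 1 ≤ p) {U V : EuclideanSpace ℂ (Fin n) → ℂ}
    (hU : IsBergmanFunction n p U) (hV : IsBergmanFunction n p V)
    (h : U =ᵐ[measureHat n p] V) : EqOn U V (allRotations n) := by
  intro z hz
  obtain ⟨K, -, hK⟩ := exists_norm_apply_le hp hz
  have h1 := hK _ (hV.smul_add (-1) hU)
  have h2 : ∫ z, ‖((-1 : ℂ) • V + U) z‖ ^ 2 ∂measureHat n p = 0 := by
    rw [← integral_zero (EuclideanSpace ℂ (Fin n)) ℝ]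
    refine integral_congr_ae ?_
    filter_upwards [h] with w hw
    simp [hw]
  rw [h2, Real.sqrt_zero, mul_zero, norm_le_zero_iff] at h1
  simp only [Pi.add_apply, neg_smul, one_smul, Pi.neg_apply] at h1
  exact (neg_add_eq_zero.1 h1).symm

/-! ### Completeness -/

/-- The homogeneous polynomials of degree `k` annihilated by the `p`-th power of the Laplacian. -/
def polyharmonicPoly (n p k : ℕ) : Submodule ℂ (MvPolynomial (Fin n) ℂ) :=
  homogeneousSubmodule (Fin n) ℂ k ⊓ LinearMap.ker (polyLap ^ p)

instance (k : ℕ) : FiniteDimensional ℂ (polyharmonicPoly n p k) := by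
  have h : FiniteDimensional ℂ (homogeneousSubmodule (Fin n) ℂ k) :=
    Module.Finite.iff_fg.2 (weightedHomogeneousSubmodule_fg ℂ 1 (fun _ => one_ne_zero) k)
  exact Submodule.finiteDimensional_of_le inf_le_left

/-- Evaluation of polynomials, as a linear map. -/
def evalL (n : ℕ) : MvPolynomial (Fin n) ℂ →ₗ[ℂ] (Fin n → ℂ) → ℂ :=
  LinearMap.pi fun z => (aeval z).toLinearMap

theorem evalL_apply (P : MvPolynomial (Fin n) ℂ) (z : Fin n → ℂ) : evalL n P z = eval z P := by
  simp [evalL, aeval_eq_eval]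

/-- A pointwise limit of homogeneous polyharmonic polynomials is such a polynomial. -/
theorem exists_limit_polynomial {k : ℕ} {Q : ℕ → MvPolynomial (Fin n) ℂ}
    (hQ : ∀ j, Q j ∈ polyharmonicPoly n p k) (h : ∀ z, CauchySeq fun j => eval z (Q j)) :
    ∃ P ∈ polyharmonicPoly n p k, ∀ z, Tendsto (fun j => eval z (Q j)) atTop (𝓝 (eval z P)) := by
  choose g hg using fun z => cauchySeq_tendsto_of_complete (h z)
  -- A finite-dimensional space of functions is closed for pointwise convergence.
  have hc : IsClosed ((polyharmonicPoly n p k).map (evalL n) : Set ((Fin n → ℂ) → ℂ)) :=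
    Submodule.closed_of_finiteDimensional _
  have hmem : g ∈ (polyharmonicPoly n p k).map (evalL n) := by
    refine hc.mem_of_tendsto (f := fun j => evalL n (Q j)) (b := atTop) ?_
      (Eventually.of_forall fun j => ⟨Q j, hQ j, rfl⟩)
    rw [tendsto_pi_nhds]
    intro z
    simpa only [evalL_apply] using hg z
  obtain ⟨P, hP, rfl⟩ := hmem
  exact ⟨P, hP, fun z => by simpa only [evalL_apply] using hg z⟩

/-- By homogeneity, halving the radius turns a uniform bound into a geometric one. -/
theorem IsLocalSum.of_bound {P : ℕ → MvPolynomial (Fin n) ℂ} (hP : ∀ k, (P k).IsHomogeneous k)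
    {ρ C : ℝ} (hρ : 0 < ρ) (h : ∀ k z, ‖z‖ ≤ ρ → ‖eval z (P k)‖ ≤ C) :
    IsLocalSum (fun x => seriesSum P (rot 0 x)) P := by
  have hb : ∀ k z, ‖z‖ ≤ ρ / 2 → ‖eval z (P k)‖ ≤ C * (1 / 2) ^ k := by
    intro k z hz
    have h1 : z = (1 / 2 : ℂ) • (2 : ℂ) • z := by simp [smul_smul]
    rw [h1, eval_smul_of_isHomogeneous (hP k), norm_mul, norm_pow, mul_comm]
    refine mul_le_mul (h k _ ?_) (by norm_num) (by positivity)
      ((norm_nonneg _).trans (h k 0 (by simpa using hρ.le)))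
    rw [norm_smul]
    norm_num
    linarith
  refine ⟨ρ / 2, C, by positivity, hb, fun x hx => ?_⟩
  simp only [seriesSum, ofLp_rot_zero]
  exact (Summable.of_norm_bounded (summable_half C)
    fun k => hb k _ ((norm_cx_le x).trans hx)).hasSum

theorem integral_norm_sq_sub {f g : L2Hat n p} {U V : EuclideanSpace ℂ (Fin n) → ℂ}
    (hf : f =ᵐ[measureHat n p] U) (hg : g =ᵐ[measureHat n p] V) :
    √(∫ z, ‖((-1 : ℂ) • V + U) z‖ ^ 2 ∂measureHat n p) = ‖f - g‖ := by
  rw [Real.sqrt_eq_iff_eq_sq (integral_nonneg fun _ => by positivity) (norm_nonneg _),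
    norm_sq_eq_integral]
  refine integral_congr_ae ?_
  filter_upwards [hf, hg, Lp.coeFn_sub f g] with z h1 h2 h3
  rw [h3, Pi.sub_apply, h1, h2]
  simp only [Pi.add_apply, neg_smul, one_smul, Pi.neg_apply, neg_add_eq_sub]

theorem sqrt_integral_norm_sq {f : L2Hat n p} {U : EuclideanSpace ℂ (Fin n) → ℂ}
    (hf : f =ᵐ[measureHat n p] U) : √(∫ z, ‖U z‖ ^ 2 ∂measureHat n p) = ‖f‖ := by
  rw [Real.sqrt_eq_iff_eq_sq (integral_nonneg fun _ => by positivity) (norm_nonneg _),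
    norm_sq_eq_integral]
  refine integral_congr_ae ?_
  filter_upwards [hf] with z h1
  rw [h1]

/-- Components depend linearly on the function, so the estimate near 0 applies to differences.
Homogeneity carries the conclusion from small points to arbitrary `z`. -/
theorem cauchySeq_eval_components (hp : 1 ≤ p) {f : ℕ → L2Hat n p} (hf : CauchySeq f)
    {U : ℕ → EuclideanSpace ℂ (Fin n) → ℂ} (hU : ∀ j, IsBergmanFunction n p (U j))
    (hfU : ∀ j, f j =ᵐ[measureHat n p] U j) {P : ℕ → ℕ → MvPolynomial (Fin n) ℂ}
    (hP : ∀ j, HasComponents p (U j) (P j)) (k : ℕ) (z : Fin n → ℂ) :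
    CauchySeq fun j => eval z (P j k) := by
  obtain ⟨ρ, θ, K, hρ, hθ0, hθ1, hK, h⟩ :=
    exists_norm_eval_component_le (n := n) hp zero_mem_allRotations
  obtain ⟨s, hs0, hsz⟩ : ∃ s : ℝ, 0 < s ∧ ‖(s : ℂ) • z‖ ≤ ρ := by
    refine ⟨ρ / (‖z‖ + 1), by positivity, ?_⟩
    rw [norm_smul, Complex.norm_real, Real.norm_eq_abs, abs_of_pos (by positivity), div_mul_eq_mul_div,
      div_le_iff₀ (by positivity)]
    nlinarith [norm_nonneg z]
  have hs : (s : ℂ) ^ k ≠ 0 := pow_ne_zero _ (by exact_mod_cast hs0.ne')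
  have h1 : ∀ i j, ‖eval ((s : ℂ) • z) (P i k) - eval ((s : ℂ) • z) (P j k)‖ ≤
      K * θ ^ k * dist (f i) (f j) := by
    intro i j
    have h2 := h _ _ ((hU j).smul_add (-1) (hU i)) ((hP j).smul_add (-1) (hP i)) k ((s : ℂ) • z)
      (by simpa using hsz)
    rw [integral_norm_sq_sub (hfU i) (hfU j), ← dist_eq_norm] at h2
    simp only [map_add, smul_eval, neg_mul, one_mul, neg_add_eq_sub] at h2
    linarith
  have h3 : CauchySeq fun j => eval ((s : ℂ) • z) (P j k) := by
    rw [Metric.cauchySeq_iff] at hf ⊢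
    intro ε hε
    obtain ⟨N, hN⟩ := hf (ε / (K * θ ^ k)) (by positivity)
    refine ⟨N, fun i hi j hj => ?_⟩
    rw [dist_eq_norm]
    refine (h1 i j).trans_lt ?_
    have := hN i hi j hj
    rw [lt_div_iff₀ (by positivity)] at this
    linarith
  have h4 : ∀ j, eval z (P j k) = ((s : ℂ) ^ k)⁻¹ * eval ((s : ℂ) • z) (P j k) := fun j => by
    rw [eval_smul_of_isHomogeneous ((hP j).isHomogeneous k), inv_mul_cancel_left₀ hs]
  simp only [h4]
  obtain ⟨l, hl⟩ := cauchySeq_tendsto_of_complete h3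
  exact (hl.const_mul _).cauchySeq

/-- The Bergman space is closed in `L²`. -/
theorem isClosed_bergmanSpace (hp : 1 ≤ p) : IsClosed (bergmanSpace n p : Set (L2Hat n p)) := by
  refine IsSeqClosed.isClosed fun f g hf hfg => ?_
  choose U hU hfU using hf
  choose P hP using fun j => (hU j).exists_hasComponents
  have hlim : ∀ k, ∃ Q ∈ polyharmonicPoly n p k,
      ∀ z, Tendsto (fun j => eval z (P j k)) atTop (𝓝 (eval z Q)) := fun k => by
    refine exists_limit_polynomial (fun j => ⟨(hP j).isHomogeneous k, ?_⟩)
      (cauchySeq_eval_components hp hfg.cauchySeq hU hfU hP k)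
    rw [SetLike.mem_coe, LinearMap.mem_ker, ← polyLap_iterate_eq_pow, (hP j).polyLap_eq_zero]
  choose Q hQ hQlim using hlim
  have hQh : ∀ k, (Q k).IsHomogeneous k := fun k => (hQ k).1
  have hQp : ∀ k, polyLap^[p] (Q k) = 0 := fun k => by
    rw [polyLap_iterate_eq_pow]
    exact (hQ k).2
  obtain ⟨C, hC0, hC⟩ : ∃ C, 0 < C ∧ ∀ j, ‖f j‖ ≤ C := by
    obtain ⟨C, hC⟩ := hfg.norm.bddAbove_range
    exact ⟨max C 1, by positivity, fun j => (hC ⟨j, rfl⟩).trans (le_max_left _ _)⟩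
  -- The bounds are uniform in `j` because a convergent sequence is bounded, so they pass to the
  -- limit polynomials and also dominate the series in `hpt`.
  have hbound : ∀ z₀ ∈ allRotations n, ∃ ρ θ K : ℝ, 0 < ρ ∧ 0 < θ ∧ θ < 1 ∧
      (∀ j k z, ‖z - z₀.ofLp‖ ≤ ρ → ‖eval z (P j k)‖ ≤ K * θ ^ k) ∧
      ∀ k z, ‖z - z₀.ofLp‖ ≤ ρ → ‖eval z (Q k)‖ ≤ K * θ ^ k := by
    intro z₀ hz₀
    obtain ⟨ρ, θ, K, hρ, hθ0, hθ1, hK, h⟩ := exists_norm_eval_component_le (n := n) hp hz₀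
    have h1 : ∀ j k z, ‖z - z₀.ofLp‖ ≤ ρ → ‖eval z (P j k)‖ ≤ K * C * θ ^ k := by
      intro j k z hz
      refine (h _ _ (hU j) (hP j) k z hz).trans ?_
      rw [sqrt_integral_norm_sq (hfU j)]
      have := hC j
      gcongr
    exact ⟨ρ, θ, K * C, hρ, hθ0, hθ1, h1, fun k z hz =>
      le_of_tendsto (hQlim k z).norm (Eventually.of_forall fun j => h1 j k z hz)⟩
  have hsum : ∀ {θ : ℝ} (K : ℝ), 0 < θ → θ < 1 → Summable fun k : ℕ => K * θ ^ k :=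
    fun K h0 h1 => (summable_geometric_of_lt_one h0.le h1).mul_left K
  have hana : AnalyticOnNhd ℂ (seriesSum Q) (allRotations n) := by
    intro z hz
    obtain ⟨ρ, θ, K, hρ, hθ0, hθ1, -, h⟩ := hbound z hz
    exact analyticAt_seriesSum hρ (hsum K hθ0 hθ1) h
  have hloc : IsLocalSum (fun x => seriesSum Q (rot 0 x)) Q := by
    obtain ⟨ρ, θ, K, hρ, hθ0, hθ1, -, h⟩ := hbound 0 zero_mem_allRotations
    have hK : 0 ≤ K := by
      have := (norm_nonneg _).trans (h 0 0 (by simpa using hρ.le))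
      simpa using this
    refine IsLocalSum.of_bound hQh hρ (C := K) fun k z hz => ?_
    exact (h k z (by simpa using hz)).trans
      (mul_le_of_le_one_right hK (pow_le_one₀ hθ0.le hθ1.le))
  have hpoly : IsPolyharmonicOn p (fun x => seriesSum Q (rot 0 x)) (unitBall n) := by
    refine (isPolyharmonicOn_iff (fun x hx => ?_) hloc hQh).2 hQp
    exact analyticAt_comp_rot_zero (hana _ (rot_mem_allRotations 0 (by simpa [unitBall] using hx)))
  have hpt : ∀ z ∈ allRotations n, Tendsto (fun j => U j z) atTop (𝓝 (seriesSum Q z)) := by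
    intro z hz
    obtain ⟨ρ, θ, K, hρ, hθ0, hθ1, h, -⟩ := hbound z hz
    have h1 : ∀ j, U j z = ∑' k, eval z.ofLp (P j k) := fun j => (hP j).eqOn (hU j) hz
    simp only [h1, seriesSum]
    exact tendsto_tsum_of_dominated_convergence (hsum K hθ0 hθ1) (fun k => hQlim k z.ofLp)
      (Eventually.of_forall fun j k => h j k _ (by simpa using hρ.le))
  -- A subsequence converges almost everywhere to the `L²` limit, and everywhere on the rotated
  -- balls to the limit series.
  have hae : g =ᵐ[measureHat n p] seriesSum Q := by
    obtain ⟨ns, hns, hlim⟩ := (tendstoInMeasure_of_tendsto_Lp hfg).exists_seq_tendsto_ae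
    filter_upwards [hlim, ae_all_iff.2 hfU, ae_mem_allRotations] with z h1 h2 h3
    refine tendsto_nhds_unique h1 ?_
    simp only [h2]
    exact (hpt z h3).comp hns.tendsto_atTop
  exact ⟨seriesSum Q, ⟨⟨_, hpoly, hana, fun _ _ => rfl⟩, (memLp_congr_ae hae).1 (Lp.memLp g)⟩, hae⟩

/-! ### The reproducing kernel -/

theorem toLp_mem_bergmanSpace {U : EuclideanSpace ℂ (Fin n) → ℂ} (hU : IsBergmanFunction n p U) :
    hU.2.toLp U ∈ bergmanSpace n p := ⟨U, hU, hU.2.coeFn_toLp⟩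

theorem exists_reproducing (hp : 1 ≤ p) {z : EuclideanSpace ℂ (Fin n)} (hz : z ∈ allRotations n) :
    ∃ R, IsBergmanFunction n p R ∧ ∀ U, IsBergmanFunction n p U → U z = avgInner n p U R := by
  have : CompleteSpace (bergmanSpace n p) := (isClosed_bergmanSpace hp).completeSpace_coe
  choose rep hrep hrep' using fun f : bergmanSpace n p => f.2
  obtain ⟨K, -, hK⟩ := exists_norm_apply_le (n := n) hp hz
  -- The value at `z` is the same for every Bergman representative; this makes evaluation through
  -- the chosen representatives linear, so that Riesz's theorem applies.
  have hev : ∀ (f : bergmanSpace n p) U, IsBergmanFunction n p U →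
      (f : L2Hat n p) =ᵐ[measureHat n p] U → rep f z = U z := fun f U hU hfU =>
    (hrep f).eqOn_of_ae_eq hp hU ((hrep' f).symm.trans hfU) hz
  let φ : bergmanSpace n p →L[ℂ] ℂ := LinearMap.mkContinuous
    { toFun := fun f => rep f z
      map_add' := fun f g => by
        have h := hev (f + g) _ ((hrep f).smul_add 1 (hrep g)) (by
          rw [one_smul]
          exact (Lp.coeFn_add _ _).trans ((hrep' f).add (hrep' g)))
        simpa using h
      map_smul' := fun a f => by
        have h := hev (a • f) _ ((hrep f).smul_add a (IsBergmanFunction.zero n p)) (by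
          rw [add_zero]
          exact (Lp.coeFn_smul _ _).trans ((hrep' f).const_smul a))
        simpa using h } K fun f => by
      have h := hK _ (hrep f)
      rwa [sqrt_integral_norm_sq (hrep' f)] at h
  let r : bergmanSpace n p := (InnerProductSpace.toDual ℂ (bergmanSpace n p)).symm φ
  refine ⟨rep r, hrep r, fun U hU => ?_⟩
  have h1 : inner ℂ r ⟨_, toLp_mem_bergmanSpace hU⟩ = φ ⟨_, toLp_mem_bergmanSpace hU⟩ :=
    InnerProductSpace.toDual_symm_apply
  have h2 : φ ⟨_, toLp_mem_bergmanSpace hU⟩ = U z := hev _ U hU hU.2.coeFn_toLp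
  rw [← h2, ← h1, Submodule.coe_inner, inner_eq_avgInner hp]
  exact avgInner_congr hU.2.coeFn_toLp (hrep' r)

theorem IsBergmanFunction.eqOn_of_avgInner_eq (hp : 1 ≤ p) {R R' : EuclideanSpace ℂ (Fin n) → ℂ}
    (hR : IsBergmanFunction n p R) (hR' : IsBergmanFunction n p R')
    (h : ∀ U, IsBergmanFunction n p U → avgInner n p U R = avgInner n p U R') :
    EqOn R R' (allRotations n) := by
  refine hR.eqOn_of_ae_eq hp hR' ?_
  -- Testing against `R - R'` shows that this difference has norm zero.
  have hd := h _ (hR'.smul_add (-1) hR)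
  have hsub : ((hR.2.toLp R - hR'.2.toLp R' : L2Hat n p) : EuclideanSpace ℂ (Fin n) → ℂ)
      =ᵐ[measureHat n p] (-1 : ℂ) • R' + R := by
    filter_upwards [Lp.coeFn_sub (hR.2.toLp R) (hR'.2.toLp R'), hR.2.coeFn_toLp,
      hR'.2.coeFn_toLp] with z h1 h2 h3
    rw [h1, Pi.sub_apply, h2, h3]
    simp only [Pi.add_apply, neg_smul, one_smul, Pi.neg_apply, neg_add_eq_sub]
  rw [← avgInner_congr hsub hR.2.coeFn_toLp, ← avgInner_congr hsub hR'.2.coeFn_toLp,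
    ← inner_eq_avgInner hp, ← inner_eq_avgInner hp, ← sub_eq_zero, ← inner_sub_left,
    inner_self_eq_zero, sub_eq_zero] at hd
  exact (MemLp.toLp_eq_toLp_iff hR.2 hR'.2).1 hd

theorem exists_unique_reproducingKernel (hp : 1 ≤ p) :
    ∃ R, IsReproducingKernel n p R ∧ ∀ R', IsReproducingKernel n p R' →
      ∀ x ∈ ballHat n p, ∀ y ∈ ballHat n p, R' x y = R x y := by
  choose! R hR hR' using fun (x : EuclideanSpace ℂ (Fin n)) (hx : x ∈ allRotations n) =>
    exists_reproducing (n := n) hp hx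
  refine ⟨R, fun x hx => ⟨hR x (ballHat_subset_allRotations hx),
    hR' x (ballHat_subset_allRotations hx)⟩, fun S hS x hx y hy => ?_⟩
  have hx' := ballHat_subset_allRotations hx
  exact (hS x hx).1.eqOn_of_avgInner_eq hp (hR x hx')
    (fun U hU => ((hS x hx).2 U hU).symm.trans (hR' x hx' U hU)) (ballHat_subset_allRotations hy)

end Bergman

end PolyBergman

end

theorem proposition4 (n p : ℕ) (hn : 1 ≤ n) (hp : 1 ≤ p) :
    -- every polyharmonic function on the ball has exactly one analytic continuation
    (∀ u : EuclideanSpace ℝ (Fin n) → ℂ, IsPolyharmonicOn p u (unitBall n) →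
      ∃ U, IsContinuation u U ∧ ∀ V, IsContinuation u V → Set.EqOn V U (allRotations n)) ∧
    -- the inner product of `L²` is the averaged one (Mathlib's is linear in the second variable)
    (∀ f g : L2Hat n p, inner ℂ g f = avgInner n p f g) ∧
    -- the Bergman space is a closed subspace, hence a Hilbert space
    IsClosed (bergmanSpace n p : Set (L2Hat n p)) ∧
    CompleteSpace (bergmanSpace n p) ∧
    -- with a unique reproducing kernel
    (∃ R, IsReproducingKernel n p R ∧
      ∀ R', IsReproducingKernel n p R' →
        ∀ x ∈ ballHat n p, ∀ y ∈ ballHat n p, R' x y = R x y) :=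
  ⟨fun _ hu => exists_unique_continuation hu, inner_eq_avgInner hp, isClosed_bergmanSpace hp,
    (isClosed_bergmanSpace hp).completeSpace_coe, exists_unique_reproducingKernel hp⟩
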